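/- For an integer $m\ge 0$ write $[m]=1+q+\cdots+q^{m-1}$, $(x;q)_m=\prod_{i=0}^{m-1}(1-xq^i)$ and $(x_1,\ldots,x_r;q)_m=(x_1;q)_m\cdots(x_r;q)_m$, and let $\Phi_n(q)$ be the $n$-th cyclotomic polynomial. Two rational functions (in $q$, or in $a$ and $q$, over $\mathbb{Q}$) are congruent modulo a polynomial $P$ if their difference can be written as a fraction of polynomials whose numerator is divisible by $P$ and whose denominator is relatively prime to $P$. Let $n$ be a positive odd integer. (i) For $k\ge 0$ let $$c_q(k)=[3k+1]\frac{(q;q^2)_k^3\,q^{-\binom{k+1}{2}}}{(q;q)_k^2\,(q^2;q^2)_k}.$$ If $n>1$, then $$\sum_{k=0}^{n-1}\sum_{j=0}^{k}c_q(j)\,c_q(k-j)\equiv q[n]^2\pmod{[n]\Phi_n(q)^2}.$$ (ii) Let $a$ be an indeterminate, and for $k\ge 0$ let $$c_{a,q}(k)=[3k+1]\frac{(aq,q/a,q;q^2)_k\,q^{-\binom{k+1}{2}}}{(aq,q/a;q)_k\,(q^2;q^2)_k}.$$ Then $$\sum_{k=0}^{n-1}\sum_{j=0}^{k}c_{a,q}(j)\,c_{a,q}(k-j)\equiv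 q^{1-n}[n]^2\pmod{[n](1-aq^n)(a-q^n)}.$$ -/

import Mathlib

open Polynomial

/-- The `q`-integer `[n] = 1 + q + ⋯ + q^(n-1)`. -/
def qInt {R : Type*} [CommRing R] (q : R) (n : ℕ) : R :=
  ∑ i ∈ Finset.range n, q ^ i

/-- The `q`-shifted factorial `(a;q)_n = (1-a)(1-aq)⋯(1-aq^(n-1))`. -/
def qPoch {R : Type*} [CommRing R] (a q : R) (n : ℕ) : R :=
  ∏ i ∈ Finset.range n, (1 - a * q ^ i)

/-- `c_q(k) = [3k+1] (q;q²)_k³ q^(-binom(k+1,2)) / ((q;q)_k² (q²;q²)_k)`. -/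
def cTerm {K : Type*} [Field K] (q : K) (k : ℕ) : K :=
  qInt q (3 * k + 1) *
    (qPoch q (q ^ 2) k ^ 3 * q ^ (-((k + 1).choose 2 : ℤ)) /
      (qPoch q q k ^ 2 * qPoch (q ^ 2) (q ^ 2) k))

/-- The version of `c_q(k)` with an extra parameter `a`:
`[3k+1] (aq, q/a, q; q²)_k q^(-binom(k+1,2)) / ((aq, q/a; q)_k (q²;q²)_k)`. -/
def cTermParam {K : Type*} [Field K] (a q : K) (k : ℕ) : K :=
  qInt q (3 * k + 1) *
    (qPoch (a * q) (q ^ 2) k * qPoch (q / a) (q ^ 2) k * qPoch q (q ^ 2) k *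
        q ^ (-((k + 1).choose 2 : ℤ)) /
      (qPoch (a * q) q k * qPoch (q / a) q k * qPoch (q ^ 2) (q ^ 2) k))

/-- The truncated square `∑_{k=0}^{n-1} ∑_{j=0}^{k} c(j) c(k-j)`. -/
def truncSquare {K : Type*} [Field K] (c : ℕ → K) (n : ℕ) : K :=
  ∑ k ∈ Finset.range n, ∑ j ∈ Finset.range (k + 1), c j * c (k - j)

/-- Congruence of rational functions `f, g` modulo a polynomial `P`: `f - g` can be written as a
fraction whose numerator is divisible by `P` and whose denominator has no common factor with `P`.
Here `A` is the polynomial ring and `K` its field of fractions. -/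
def RatCongr {A K : Type*} [CommRing A] [Field K] [Algebra A K] (P : A) (f g : K) : Prop :=
  ∃ N D : A, D ≠ 0 ∧ IsRelPrime D P ∧ f - g = algebraMap A K (P * N) / algebraMap A K D

/-!
The series of the `c_{a,q}(k)` is the case `(a, a⁻¹, 1)` of a terminating quadratic summation for
triples of product `1`, which a `q`-WZ pair proves for generic parameters and specialization
transfers to every point where both sides are regular.

At `a = q ^ n` and `a = q ^ (-n)` the terms vanish beyond the middle index `(n - 1) / 2`, so the
truncated square is the square of the sum, and the triple `(1, q ^ n, q ^ (-n))` evaluates that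
sum. At a primitive `d`-th root of unity with `1 < d ∣ n` the sequence is, block by block of
length `d`, proportional to its first block, which vanishes beyond its middle and, by the triple
`(a, a⁻¹, 1)`, sums to zero; hence each product of a term with the partial sum it meets in the
truncated square has a vanishing factor. As `[n]` is the product of the `Φ_d` with `1 < d ∣ n`,
these values give the parametric congruence. At `a = 1` its modulus is divisible by `Φ_n ^ 3`, while
`q ^ (1 - n) [n] ^ 2` and `q [n] ^ 2` differ by a multiple of `(1 - q ^ n) [n] ^ 2`, hence of
`Φ_n ^ 3`; the other `Φ_d` are treated at `a = 1` directly.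
-/

section QPochhammer

variable {R : Type*} [CommRing R]

@[simp] lemma qPoch_zero (a q : R) : qPoch a q 0 = 1 := by simp [qPoch]

lemma qPoch_succ (a q : R) (k : ℕ) : qPoch a q (k + 1) = qPoch a q k * (1 - a * q ^ k) :=
  Finset.prod_range_succ _ _

lemma qPoch_add (a q : R) (m k : ℕ) :
    qPoch a q (m + k) = qPoch a q m * qPoch (a * q ^ m) q k := by
  simp only [qPoch, Finset.prod_range_add, pow_add, mul_assoc]

lemma one_sub_mul_qPoch_mul (a q : R) (k : ℕ) :
    (1 - a) * qPoch (a * q) q k = qPoch a q k * (1 - a * q ^ k) := by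
  rw [← qPoch_succ, add_comm k, qPoch_add, pow_one, qPoch_succ, qPoch_zero, one_mul, pow_zero,
    mul_one]

lemma qPoch_sq_sq (a q : R) (k : ℕ) :
    qPoch (a ^ 2) (q ^ 2) k = qPoch a q k * qPoch (-a) q k := by
  rw [qPoch, qPoch, qPoch, ← Finset.prod_mul_distrib]
  exact Finset.prod_congr rfl fun i _ => by ring

lemma qPoch_ne_zero [IsDomain R] {a q : R} {k : ℕ} (h : ∀ i < k, a * q ^ i ≠ 1) :
    qPoch a q k ≠ 0 :=
  Finset.prod_ne_zero_iff.2 fun i hi => sub_ne_zero.2 (h i (Finset.mem_range.1 hi)).symm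

lemma qPoch_eq_zero {a q : R} {k i : ℕ} (hi : i < k) (h : a * q ^ i = 1) : qPoch a q k = 0 :=
  Finset.prod_eq_zero (Finset.mem_range.2 hi) (by rw [h, sub_self])

lemma one_sub_mul_qInt (q : R) (n : ℕ) : (1 - q) * qInt q n = 1 - q ^ n :=
  mul_neg_geom_sum q n

lemma qInt_eq_zero [IsDomain R] {q : R} {n : ℕ} (hq : q ≠ 1) (hn : q ^ n = 1) : qInt q n = 0 :=
  (mul_eq_zero.1 ((one_sub_mul_qInt q n).trans (by rw [hn, sub_self]))).resolve_left
    (sub_ne_zero.2 hq.symm)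

lemma qPoch_eq_qPoch_mul_div {K : Type*} [Field K] {a q : K} {k : ℕ} (h : a * q ^ k ≠ 1) :
    qPoch a q k = qPoch (a * q) q k * ((1 - a) / (1 - a * q ^ k)) := by
  rw [← mul_div_assoc, eq_div_iff (sub_ne_zero.2 h.symm), ← one_sub_mul_qPoch_mul, mul_comm]

lemma qPoch_mul_eq_qPoch_mul_div {K : Type*} [Field K] {a q : K} (h : a ≠ 1) (k : ℕ) :
    qPoch (a * q) q k = qPoch a q k * ((1 - a * q ^ k) / (1 - a)) := by
  rw [← mul_div_assoc, eq_div_iff (sub_ne_zero.2 h.symm), ← one_sub_mul_qPoch_mul, mul_comm]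

lemma zpow_neg_choose_succ {K : Type*} [Field K] {q : K} (hq : q ≠ 0) (k : ℕ) :
    q ^ (-((k + 1 + 1).choose 2 : ℤ)) = q ^ (-((k + 1).choose 2 : ℤ)) / q ^ (k + 1) := by
  rw [Nat.choose_succ_succ' (k + 1) 1, Nat.choose_one_right, ← zpow_natCast, ← zpow_sub₀ hq]
  push_cast
  ring_nf

end QPochhammer

section Specialization

variable {A K L : Type*} [CommRing A] [Field K] [Algebra A K] [Field L]

/-- The graph of the specialization map induced by a ring homomorphism `φ` from `A` to a field:
the pairs `(N / D, φ N / φ D)` with `φ D ≠ 0`. As a relation on all of `K` it makes sense without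
localizing `A` at the kernel of `φ`. -/
def specialization (φ : A →+* L) : Subring (K × L) where
  carrier := {p | ∃ N D : A, φ D ≠ 0 ∧ p.1 * algebraMap A K D = algebraMap A K N ∧
    p.2 * φ D = φ N}
  zero_mem' := ⟨0, 1, by simp⟩
  one_mem' := ⟨1, 1, by simp⟩
  neg_mem' := by
    rintro ⟨f, v⟩ ⟨N, D, hD, hf, hv⟩
    exact ⟨-N, D, hD, by simpa using hf, by simpa using hv⟩
  add_mem' := by
    rintro ⟨f, v⟩ ⟨g, w⟩ ⟨N, D, hD, hf, hv⟩ ⟨N', D', hD', hg, hw⟩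
    refine ⟨N * D' + N' * D, D * D', by simp [hD, hD'], ?_, ?_⟩ <;>
      simp only [Prod.fst_add, Prod.snd_add, map_add, map_mul]
    · linear_combination algebraMap A K D' * hf + algebraMap A K D * hg
    · linear_combination φ D' * hv + φ D * hw
  mul_mem' := by
    rintro ⟨f, v⟩ ⟨g, w⟩ ⟨N, D, hD, hf, hv⟩ ⟨N', D', hD', hg, hw⟩
    refine ⟨N * N', D * D', by simp [hD, hD'], ?_, ?_⟩ <;>
      simp only [Prod.fst_mul, Prod.snd_mul, map_mul]
    · rw [mul_mul_mul_comm, hf, hg]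
    · rw [mul_mul_mul_comm, hv, hw]

/-- The rational function `f` is regular at the specialization `φ` and takes the value `v` there. -/
def SpecializesTo (φ : A →+* L) (f : K) (v : L) : Prop :=
  (f, v) ∈ specialization φ

namespace SpecializesTo

variable {φ : A →+* L} {f g : K} {v w : L}

lemma of_algebraMap (φ : A →+* L) (x : A) : SpecializesTo φ (algebraMap A K x) (φ x) :=
  ⟨x, 1, by simp⟩

lemma one (φ : A →+* L) : SpecializesTo φ (1 : K) 1 := one_mem (specialization φ)

lemma neg (hf : SpecializesTo φ f v) : SpecializesTo φ (-f) (-v) := neg_mem hf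

lemma sub (hf : SpecializesTo φ f v) (hg : SpecializesTo φ g w) :
    SpecializesTo φ (f - g) (v - w) :=
  sub_mem hf hg

lemma mul (hf : SpecializesTo φ f v) (hg : SpecializesTo φ g w) :
    SpecializesTo φ (f * g) (v * w) :=
  mul_mem hf hg

lemma pow (hf : SpecializesTo φ f v) (n : ℕ) : SpecializesTo φ (f ^ n) (v ^ n) :=
  pow_mem hf n

lemma sum {ι : Type*} {s : Finset ι} {f : ι → K} {v : ι → L}
    (h : ∀ i ∈ s, SpecializesTo φ (f i) (v i)) :
    SpecializesTo φ (∑ i ∈ s, f i) (∑ i ∈ s, v i) := by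
  simpa only [SpecializesTo, ← prod_mk_sum] using sum_mem h

lemma prod {ι : Type*} {s : Finset ι} {f : ι → K} {v : ι → L}
    (h : ∀ i ∈ s, SpecializesTo φ (f i) (v i)) :
    SpecializesTo φ (∏ i ∈ s, f i) (∏ i ∈ s, v i) := by
  simpa only [SpecializesTo, ← prod_mk_prod] using prod_mem h

section IsFractionRing

variable [IsFractionRing A K]

lemma inv (hf : SpecializesTo φ f v) (hv : v ≠ 0) : SpecializesTo φ f⁻¹ v⁻¹ := by
  obtain ⟨N, D, hD, hfD, hvD⟩ := hf
  have hN : φ N ≠ 0 := hvD ▸ mul_ne_zero hv hD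
  have hN' : algebraMap A K N ≠ 0 := fun h =>
    hN (by rw [(map_eq_zero_iff _ (IsFractionRing.injective A K)).1 h, map_zero])
  have hf0 : f ≠ 0 := left_ne_zero_of_mul (hfD ▸ hN')
  exact ⟨D, N, hN, by rw [← hfD, inv_mul_cancel_left₀ hf0], by
    rw [← hvD, inv_mul_cancel_left₀ hv]⟩

lemma div (hf : SpecializesTo φ f v) (hg : SpecializesTo φ g w) (hw : w ≠ 0) :
    SpecializesTo φ (f / g) (v / w) := by
  simpa only [div_eq_mul_inv] using hf.mul (hg.inv hw)

lemma zpow (hf : SpecializesTo φ f v) (hv : v ≠ 0) (n : ℤ) : SpecializesTo φ (f ^ n) (v ^ n) := by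
  cases n with
  | ofNat n => simpa only [Int.ofNat_eq_natCast, zpow_natCast] using hf.pow n
  | negSucc n => simpa only [zpow_negSucc] using (hf.pow (n + 1)).inv (pow_ne_zero _ hv)

lemma map_num_eq (hf : SpecializesTo φ f v) {U V : A}
    (h : f * algebraMap A K V = algebraMap A K U) : φ U = v * φ V := by
  obtain ⟨N, D, hD, hfD, hvD⟩ := hf
  have hcross : U * D = N * V := by
    apply IsFractionRing.injective A K
    rw [map_mul, map_mul, ← h, ← hfD, mul_right_comm]
  apply mul_right_cancel₀ hD
  rw [← map_mul, hcross, map_mul, ← hvD, mul_right_comm]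

lemma unique (hf : SpecializesTo φ f v) (hf' : SpecializesTo φ f w) : v = w := by
  obtain ⟨N, D, hD, hfD, hvD⟩ := hf
  exact mul_right_cancel₀ hD (hvD.trans (hf'.map_num_eq hfD))

end IsFractionRing

lemma qPoch {q x : K} {κ ξ : L} (hx : SpecializesTo φ x ξ) (hq : SpecializesTo φ q κ) (k : ℕ) :
    SpecializesTo φ (qPoch x q k) (qPoch ξ κ k) :=
  prod fun i _ => (one φ).sub (hx.mul (hq.pow i))

lemma qInt {q : K} {κ : L} (hq : SpecializesTo φ q κ) (k : ℕ) :
    SpecializesTo φ (qInt q k) (qInt κ k) :=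
  sum fun i _ => hq.pow i

lemma truncSquare {c : ℕ → K} {γ : ℕ → L} {n : ℕ}
    (h : ∀ k < n, SpecializesTo φ (c k) (γ k)) :
    SpecializesTo φ (truncSquare c n) (truncSquare γ n) :=
  sum fun k hk => sum fun j hj => by
    rw [Finset.mem_range] at hk hj
    exact (h j (by omega)).mul (h (k - j) (by omega))

end SpecializesTo

end Specialization

section QuadraticSummation

variable {K : Type*} [Field K]

/-- The coefficient `(aq, bq, cq; q²)_k q^(-binom(k+1,2)) / ((q/a, q/b, q/c, -q; q)_k)` of
`[3k+1]` in `tripleTerm`. -/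
def tripleCoeff (q a b c : K) (k : ℕ) : K :=
  qPoch (a * q) (q ^ 2) k * qPoch (b * q) (q ^ 2) k * qPoch (c * q) (q ^ 2) k *
      q ^ (-((k + 1).choose 2 : ℤ)) /
    (qPoch (q / a) q k * qPoch (q / b) q k * qPoch (q / c) q k * qPoch (-q) q k)

/-- The summand of the quadratic summation, intended for `a * b * c = 1`. It is symmetric in
`a`, `b`, `c`, and the term `c_{a,q}(k)` is the case of the triple `a, a⁻¹, 1`. -/
def tripleTerm (q a b c : K) (k : ℕ) : K :=
  qInt q (3 * k + 1) * tripleCoeff q a b c k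

lemma tripleCoeff_eq_zero {q : K} (hq : q ≠ 0) {a b : K} {N k : ℕ} (hk : N < k) :
    tripleCoeff q a b (q ^ (2 * N + 1))⁻¹ k = 0 := by
  have h : (q ^ (2 * N + 1))⁻¹ * q * (q ^ 2) ^ N = 1 := by
    rw [← pow_mul, mul_assoc, ← pow_succ', inv_mul_cancel₀ (pow_ne_zero _ hq)]
  rw [tripleCoeff, qPoch_eq_zero hk h, mul_zero, zero_mul, zero_div]

lemma tripleCoeff_succ {q a w : K} (hq : q ≠ 0) (ha : a ≠ 0) (hw : w ≠ 0) (k : ℕ) :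
    tripleCoeff q a (w / a) w⁻¹ (k + 1) = tripleCoeff q a (w / a) w⁻¹ k *
      ((1 - a * q * (q ^ k) ^ 2) * (a - w * q * (q ^ k) ^ 2) * (w - q * (q ^ k) ^ 2) /
        (q * q ^ k * (a - q * q ^ k) * (w - a * q * q ^ k) * (1 - w * q * q ^ k) *
          (1 + q * q ^ k))) := by
  have h1 : (1 - w / a * q * (q ^ 2) ^ k) = (a - w * q * (q ^ k) ^ 2) / a := by
    rw [← pow_mul, ← pow_mul, mul_comm 2 k]; field_simp
  have h2 : (1 - w⁻¹ * q * (q ^ 2) ^ k) = (w - q * (q ^ k) ^ 2) / w := by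
    rw [← pow_mul, ← pow_mul, mul_comm 2 k]; field_simp
  have h3 : (1 - q / a * q ^ k) = (a - q * q ^ k) / a := by field_simp
  have h4 : (1 - q / (w / a) * q ^ k) = (w - a * q * q ^ k) / w := by field_simp
  have h5 : (1 - q / w⁻¹ * q ^ k) = 1 - w * q * q ^ k := by rw [div_inv_eq_mul, mul_comm q]
  rw [tripleCoeff, zpow_neg_choose_succ hq]
  simp only [qPoch_succ, h1, h2, h3, h4, h5, sub_neg_eq_add, neg_mul]
  calc
    _ = tripleCoeff q a (w / a) w⁻¹ k *
        ((1 - a * q * (q ^ 2) ^ k) * ((a - w * q * (q ^ k) ^ 2) / a) *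
            ((w - q * (q ^ k) ^ 2) / w) * (q ^ (k + 1))⁻¹ /
          ((a - q * q ^ k) / a * ((w - a * q * q ^ k) / w) * (1 - w * q * q ^ k) *
            (1 + q * q ^ k))) := by
      rw [tripleCoeff, ← mul_div_mul_comm]
      congr 1 <;> ring
    _ = _ := by
      rw [← pow_mul, mul_comm 2 k, pow_mul, pow_succ' q k]
      field_simp

lemma qPoch_div_div_shift {q a w : K} (hq : q ≠ 0) (ha : a ≠ 0) (hw : w ≠ 0) (k : ℕ)
    (h1 : w * q - a ≠ 0) (h2 : w - a ≠ 0) :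
    qPoch (q / (w / a)) q k = qPoch (q / (w * q ^ 2 / a)) q k *
      ((w * q - a * q ^ k) * (w - a * q ^ k) / ((w * q - a) * (w - a))) := by
  rw [show q / (w / a) = q / (w * q ^ 2 / a) * q * q by field_simp, qPoch_mul_eq_qPoch_mul_div,
    qPoch_mul_eq_qPoch_mul_div, mul_assoc]
  · congr 1
    field_simp
  · refine fun h => h1 ?_
    field_simp at h
    linear_combination -h
  · refine fun h => h2 ?_
    field_simp at h
    linear_combination -h

lemma qPoch_div_inv_shift {q w : K} (k : ℕ) (h1 : 1 - w * q * q ^ k ≠ 0)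
    (h2 : 1 - w * q ^ 2 * q ^ k ≠ 0) :
    qPoch (q / w⁻¹) q k = qPoch (q / (w * q ^ 2)⁻¹) q k *
      ((1 - w * q) * (1 - w * q ^ 2) / ((1 - w * q * q ^ k) * (1 - w * q ^ 2 * q ^ k))) := by
  simp only [div_inv_eq_mul]
  rw [show q * (w * q ^ 2) = q * w * q * q by ring, qPoch_eq_qPoch_mul_div (a := q * w),
    qPoch_eq_qPoch_mul_div (a := q * w * q)]
  · rw [mul_assoc, div_mul_div_comm]
    congr 2 <;> ring
  · exact fun h => h2 (by linear_combination -h)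
  · exact fun h => h1 (by linear_combination -h)

lemma tripleCoeff_shift {q a w : K} (hq : q ≠ 0) (ha : a ≠ 0) (hw : w ≠ 0) (k : ℕ)
    (h1 : a - w * q * (q ^ k) ^ 2 ≠ 0) (h2 : w * q - 1 ≠ 0) (h3 : w * q - a ≠ 0)
    (h4 : w - a ≠ 0) (h5 : 1 - w * q * q ^ k ≠ 0) (h6 : 1 - w * q ^ 2 * q ^ k ≠ 0) :
    tripleCoeff q a (w / a) w⁻¹ k = tripleCoeff q a (w * q ^ 2 / a) (w * q ^ 2)⁻¹ k *
      ((a - w * q) * (w * q - (q ^ k) ^ 2) * (w * q - a) * (w - a) *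
          (1 - w * q * q ^ k) * (1 - w * q ^ 2 * q ^ k) /
        ((a - w * q * (q ^ k) ^ 2) * (w * q - 1) * (w * q - a * q ^ k) * (w - a * q ^ k) *
          (1 - w * q) * (1 - w * q ^ 2))) := by
  have hsq : (q ^ 2) ^ k = (q ^ k) ^ 2 := by rw [← pow_mul, ← pow_mul, mul_comm]
  have e1 : qPoch (w / a * q) (q ^ 2) k = qPoch (w * q ^ 2 / a * q) (q ^ 2) k *
      ((a - w * q) / (a - w * q * (q ^ k) ^ 2)) := by
    rw [qPoch_eq_qPoch_mul_div (a := w / a * q), hsq]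
    · rw [show w / a * q * q ^ 2 = w * q ^ 2 / a * q by ring]
      congr 1
      field_simp
    · rw [hsq]
      refine fun h => h1 ?_
      field_simp at h
      linear_combination -h
  have e2 : qPoch (w⁻¹ * q) (q ^ 2) k = qPoch ((w * q ^ 2)⁻¹ * q) (q ^ 2) k *
      ((w * q - (q ^ k) ^ 2) / (w * q - 1)) := by
    rw [show w⁻¹ * q = (w * q ^ 2)⁻¹ * q * q ^ 2 by field_simp, qPoch_mul_eq_qPoch_mul_div, hsq]
    · congr 1
      field_simp
    · refine fun h => h2 ?_
      field_simp at h
      linear_combination -h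
  rw [tripleCoeff, tripleCoeff, e1, e2, qPoch_div_div_shift hq ha hw k h3 h4,
    qPoch_div_inv_shift k h5 h6]
  simp only [div_eq_mul_inv, mul_inv, inv_inv]
  ring

lemma mul_tripleCoeff_shift {q a w : K} (hq : q ≠ 0) (ha : a ≠ 0) (hw : w ≠ 0) (k : ℕ)
    (h1 : a - w ≠ 0) (h2 : a - w * q ≠ 0) (h3 : a - (q ^ k) ^ 2 * (w * q) ≠ 0)
    (h4 : 1 - w * q ≠ 0) (h5 : 1 - w * q ^ 2 ≠ 0) (h6 : w * q - q ^ k * a ≠ 0)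
    (h7 : 1 - w * q * q ^ k ≠ 0) (h8 : 1 - w * q ^ 2 * q ^ k ≠ 0) :
    a * (1 - w * q) * (1 - w * q ^ 2) / (q * (a - w) * (a - w * q)) *
        tripleCoeff q a (w / a) w⁻¹ k =
      -(a * (a - w * q) * (w * q - (q ^ k) ^ 2) * (1 - q ^ k * (w * q)) *
            (1 - q * q ^ k * (w * q)) /
          ((1 - w * q) * (a - (q ^ k) ^ 2 * (w * q)) * (w * q - q ^ k * a) *
            (w * q - q * q ^ k * a))) *
        tripleCoeff q a (w * q ^ 2 / a) (w * q ^ 2)⁻¹ k := by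
  rw [tripleCoeff_shift hq ha hw k (by rwa [mul_comm]) (sub_ne_zero.2 (sub_ne_zero.1 h4).symm)
    (sub_ne_zero.2 (sub_ne_zero.1 h2).symm) (sub_ne_zero.2 (sub_ne_zero.1 h1).symm) h7 h8,
    show w * q - q * q ^ k * a = q * (w - a * q ^ k) by ring]
  generalize tripleCoeff q a (w * q ^ 2 / a) (w * q ^ 2)⁻¹ k = T
  generalize q ^ k = Q at *
  rw [show w * q - a = -(a - w * q) by ring, show w - a = -(a - w) by ring,
    show w * q - 1 = -(1 - w * q) by ring, show 1 - w * q * Q = 1 - Q * (w * q) by ring,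
    show 1 - w * q ^ 2 * Q = 1 - q * Q * (w * q) by ring,
    show a - w * q * Q ^ 2 = a - Q ^ 2 * (w * q) by ring,
    show w * q - a * Q = w * q - Q * a by ring]
  generalize a - w * q = d1, a - w = d2, 1 - w * q = d3, 1 - w * q ^ 2 = d4,
    a - Q ^ 2 * (w * q) = d5, w * q - Q * a = d6 at *
  field_simp

/-- The `q`-WZ companion of `tripleTerm q a (w / a) w⁻¹` for the step `w ↦ w * q ^ 2`, which is
`N ↦ N + 1` in `w = q ^ (2 * N + 1)`: its differences in `k` are combinations of the two
summands, so that their sums over `k` telescope. -/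
def tripleCert (q a w : K) (k : ℕ) : K :=
  q ^ k * (a - (w * q) ^ 2) * (1 - (q ^ k) ^ 2) * (a - q ^ k) * (1 - q * q ^ k * (w * q)) /
      ((a - (q ^ k) ^ 2 * (w * q)) * (1 - w * q) * (w * q - q ^ k * a)) *
    (tripleCoeff q a (w * q ^ 2 / a) (w * q ^ 2)⁻¹ k / (1 - q))

lemma tripleCert_zero (q a w : K) : tripleCert q a w 0 = 0 := by simp [tripleCert]

lemma tripleCert_succ {q a w : K} (hq : q ≠ 0) (ha : a ≠ 0) (hw : w ≠ 0) (k : ℕ)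
    (h1 : a - w * q * (q * q ^ k) ^ 2 ≠ 0) (h2 : a - q * q ^ k ≠ 0)
    (h3 : 1 - w * q ^ 3 * q ^ k ≠ 0) (h4 : 1 + q * q ^ k ≠ 0) :
    tripleCert q a w (k + 1) =
      (a - (w * q) ^ 2) * (1 - q * q ^ k) * (1 - q * (q ^ k) ^ 2 * a) * (w * q - (q ^ k) ^ 2) /
          ((1 - w * q) * (w * q - q ^ k * a) * (w * q - q * q ^ k * a)) *
        (tripleCoeff q a (w * q ^ 2 / a) (w * q ^ 2)⁻¹ k / (1 - q)) := by
  rw [tripleCert, tripleCoeff_succ hq ha (mul_ne_zero hw (pow_ne_zero 2 hq)), pow_succ' q k]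
  generalize tripleCoeff q a (w * q ^ 2 / a) (w * q ^ 2)⁻¹ k = T
  have hQ : q ^ k ≠ 0 := pow_ne_zero k hq
  generalize q ^ k = Q at *
  rw [show w * q ^ 2 - a * q * Q = q * (w * q - Q * a) by ring,
    show 1 - w * q ^ 2 * q * Q = 1 - w * q ^ 3 * Q by ring,
    show 1 - q * (q * Q) * (w * q) = 1 - w * q ^ 3 * Q by ring,
    show a - (q * Q) ^ 2 * (w * q) = a - w * q * (q * Q) ^ 2 by ring,
    show a - w * q ^ 2 * q * Q ^ 2 = a - w * q * (q * Q) ^ 2 by ring,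
    show 1 - (q * Q) ^ 2 = (1 - q * Q) * (1 + q * Q) by ring,
    show w * q ^ 2 - q * Q ^ 2 = q * (w * q - Q ^ 2) by ring,
    show 1 - a * q * Q ^ 2 = 1 - q * Q ^ 2 * a by ring]
  generalize a - w * q * (q * Q) ^ 2 = d1, a - q * Q = d2, 1 - w * q ^ 3 * Q = d3,
    1 + q * Q = d4, 1 - w * q = d5, w * q - Q * a = d6, w * q - q * Q * a = d7, 1 - q = d8 at *
  field_simp

/-- Here `Q` stands for `q ^ k` and `u` for `w * q`. -/
lemma tripleCert_identity {q a u Q : K} (h1 : a - Q ^ 2 * u ≠ 0) (h2 : 1 - u ≠ 0)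
    (h3 : u - Q * a ≠ 0) (h4 : u - q * Q * a ≠ 0) :
    (1 - q * Q ^ 3) * (1 + a * (a - u) * (u - Q ^ 2) * (1 - Q * u) * (1 - q * Q * u) /
        ((1 - u) * (a - Q ^ 2 * u) * (u - Q * a) * (u - q * Q * a))) =
      (a - u ^ 2) * (1 - q * Q) * (1 - q * Q ^ 2 * a) * (u - Q ^ 2) /
          ((1 - u) * (u - Q * a) * (u - q * Q * a)) -
        Q * (a - u ^ 2) * (1 - Q ^ 2) * (a - Q) * (1 - q * Q * u) /
          ((a - Q ^ 2 * u) * (1 - u) * (u - Q * a)) := by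
  field_simp
  ring

section Generic

variable {q a : K} (hq : q ≠ 0) (hq1 : ∀ i, 0 < i → q ^ i ≠ 1) (ha : a ≠ 0)
  (haq : ∀ i j, a * q ^ i ≠ q ^ j)

include hq hq1 ha haq

lemma tripleTerm_shift_sub_eq_tripleCert_sub {w : K} {m : ℕ} (hwm : w = q ^ m) (k : ℕ) :
    tripleTerm q a (w * q ^ 2 / a) (w * q ^ 2)⁻¹ k -
        a * (1 - w * q) * (1 - w * q ^ 2) / (q * (a - w) * (a - w * q)) *
          tripleTerm q a (w / a) w⁻¹ k =
      tripleCert q a w (k + 1) - tripleCert q a w k := by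
  have hw : w ≠ 0 := hwm ▸ pow_ne_zero m hq
  have one_sub (i : ℕ) (hi : 0 < i) : 1 - q ^ i ≠ 0 := sub_ne_zero.2 (hq1 i hi).symm
  have a_sub (j : ℕ) : a - q ^ j ≠ 0 := by simpa using sub_ne_zero.2 (haq 0 j)
  have pow_sub_mul (i j : ℕ) : q ^ j - q ^ i * a ≠ 0 := by
    simpa only [mul_comm] using sub_ne_zero.2 (haq i j).symm
  have one_add : 1 + q * q ^ k ≠ 0 := fun h => one_sub (2 * (k + 1)) (by omega) (by
    rw [mul_comm 2, pow_mul, pow_succ']; linear_combination (1 - q * q ^ k) * h)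
  have one_sub_q : 1 - q ≠ 0 := by simpa using one_sub 1 one_pos
  have a_sub_w : a - w ≠ 0 := hwm ▸ a_sub m
  have a_sub_wq : a - w * q ≠ 0 := by rw [hwm, ← pow_succ]; exact a_sub _
  have a_sub_sq_mul : a - (q ^ k) ^ 2 * (w * q) ≠ 0 := by
    rw [hwm, ← pow_succ, ← pow_mul, ← pow_add]; exact a_sub _
  have one_sub_wq : 1 - w * q ≠ 0 := by rw [hwm, ← pow_succ]; exact one_sub _ (by omega)
  have one_sub_wq2 : 1 - w * q ^ 2 ≠ 0 := by rw [hwm, ← pow_add]; exact one_sub _ (by omega)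
  have wq_sub : w * q - q ^ k * a ≠ 0 := by rw [hwm, ← pow_succ]; exact pow_sub_mul _ _
  have wq_sub_succ : w * q - q * q ^ k * a ≠ 0 := by
    rw [hwm, ← pow_succ, ← pow_succ']; exact pow_sub_mul _ _
  have one_sub_wq_mul : 1 - w * q * q ^ k ≠ 0 := by
    rw [hwm, ← pow_succ, ← pow_add]; exact one_sub _ (by omega)
  have one_sub_wq2_mul : 1 - w * q ^ 2 * q ^ k ≠ 0 := by
    rw [hwm, ← pow_add, ← pow_add]; exact one_sub _ (by omega)
  have one_sub_wq3_mul : 1 - w * q ^ 3 * q ^ k ≠ 0 := by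
    rw [hwm, ← pow_add, ← pow_add]; exact one_sub _ (by omega)
  have a_sub_sq_mul_succ : a - w * q * (q * q ^ k) ^ 2 ≠ 0 := by
    rw [hwm, ← pow_succ, ← pow_succ', ← pow_mul, ← pow_add]; exact a_sub _
  have a_sub_succ : a - q * q ^ k ≠ 0 := by rw [← pow_succ']; exact a_sub _
  have hint : qInt q (3 * k + 1) = (1 - q * (q ^ k) ^ 3) / (1 - q) := by
    rw [eq_div_iff one_sub_q, mul_comm, one_sub_mul_qInt, pow_succ', ← pow_mul, mul_comm 3]
  have hshift := mul_tripleCoeff_shift hq ha hw k a_sub_w a_sub_wq a_sub_sq_mul one_sub_wq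
    one_sub_wq2 wq_sub one_sub_wq_mul one_sub_wq2_mul
  rw [tripleCert_succ hq ha hw k a_sub_sq_mul_succ a_sub_succ one_sub_wq3_mul one_add, tripleTerm,
    tripleTerm, hint, tripleCert]
  linear_combination -(1 - q * (q ^ k) ^ 3) / (1 - q) * hshift +
    tripleCoeff q a (w * q ^ 2 / a) (w * q ^ 2)⁻¹ k / (1 - q) *
      tripleCert_identity a_sub_sq_mul one_sub_wq wq_sub wq_sub_succ

lemma sum_tripleTerm_of_generic (N : ℕ) :
    ∑ k ∈ Finset.range (N + 1), tripleTerm q a (q ^ (2 * N + 1) / a) (q ^ (2 * N + 1))⁻¹ k =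
      qInt q (2 * N + 1) * qPoch q q (2 * N) / ((a * q) ^ N * qPoch (q / a) q (2 * N)) := by
  induction N with
  | zero => simp [tripleTerm, tripleCoeff, qInt]
  | succ N ih =>
    set w := q ^ (2 * N + 1) with hw
    have hw' : q ^ (2 * (N + 1) + 1) = w * q ^ 2 := by rw [hw, ← pow_add]; ring
    have htel : ∑ k ∈ Finset.range (N + 2), tripleTerm q a (w * q ^ 2 / a) (w * q ^ 2)⁻¹ k -
        a * (1 - w * q) * (1 - w * q ^ 2) / (q * (a - w) * (a - w * q)) *
          ∑ k ∈ Finset.range (N + 2), tripleTerm q a (w / a) w⁻¹ k = 0 := by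
      rw [Finset.mul_sum, ← Finset.sum_sub_distrib, Finset.sum_congr rfl fun k _ =>
        tripleTerm_shift_sub_eq_tripleCert_sub hq hq1 ha haq hw k, Finset.sum_range_sub,
        tripleCert_zero, tripleCert, ← hw', tripleCoeff_eq_zero hq (Nat.lt_succ_self _)]
      simp
    rw [Finset.sum_range_succ (tripleTerm q a (w / a) w⁻¹), ih, tripleTerm,
      tripleCoeff_eq_zero hq (Nat.lt_succ_self N), mul_zero, add_zero, sub_eq_zero] at htel
    have h1 : 1 - q ≠ 0 := sub_ne_zero.2 (by simpa using (hq1 1 one_pos).symm)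
    have hint (n : ℕ) : qInt q n = (1 - q ^ n) / (1 - q) := by
      rw [eq_div_iff h1, mul_comm, one_sub_mul_qInt]
    rw [hw', htel, hint, hint, hw', ← hw, Nat.mul_succ, qPoch_succ, qPoch_succ, qPoch_succ,
      qPoch_succ, pow_succ (a * q) N, show q * q ^ (2 * N) = w by rw [hw]; ring,
      show q * q ^ (2 * N + 1) = w * q by rw [hw]; ring,
      show 1 - q / a * q ^ (2 * N) = (a - w) / a by rw [hw]; field_simp; ring,
      show 1 - q / a * q ^ (2 * N + 1) = (a - w * q) / a by rw [hw]; field_simp]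
    field_simp

end Generic

end QuadraticSummation

section Transfer

lemma qPoch_ne_zero_of_le {R : Type*} [CommRing R] {a q : R} {k m : ℕ} (hkm : k ≤ m)
    (h : qPoch a q m ≠ 0) : qPoch a q k ≠ 0 := by
  rw [← Nat.add_sub_cancel' hkm, qPoch_add] at h
  exact left_ne_zero_of_mul h

lemma SpecializesTo.tripleTerm {A K L : Type*} [CommRing A] [Field K] [Algebra A K]
    [IsFractionRing A K] [Field L] {φ : A →+* L} {q a b c : K} {κ α β γ : L}
    (hq : SpecializesTo φ q κ) (ha : SpecializesTo φ a α) (hb : SpecializesTo φ b β)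
    (hc : SpecializesTo φ c γ) (hκ : κ ≠ 0) (hα : α ≠ 0) (hβ : β ≠ 0) (hγ : γ ≠ 0) {k : ℕ}
    (h1 : _root_.qPoch (κ / α) κ k ≠ 0) (h2 : _root_.qPoch (κ / β) κ k ≠ 0)
    (h3 : _root_.qPoch (κ / γ) κ k ≠ 0) (h4 : _root_.qPoch (-κ) κ k ≠ 0) :
    SpecializesTo φ (tripleTerm q a b c k) (tripleTerm κ α β γ k) :=
  (hq.qInt _).mul ((((((ha.mul hq).qPoch (hq.pow 2) k).mul ((hb.mul hq).qPoch (hq.pow 2) k)).mul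
    ((hc.mul hq).qPoch (hq.pow 2) k)).mul (hq.zpow hκ _)).div
      (((((hq.div ha hα).qPoch hq k).mul ((hq.div hb hβ).qPoch hq k)).mul
        ((hq.div hc hγ).qPoch hq k)).mul (hq.neg.qPoch hq k))
      (mul_ne_zero (mul_ne_zero (mul_ne_zero h1 h2) h3) h4))

variable {K : Type*} [Field K]

theorem sum_tripleTerm {q a : K} (hq : q ≠ 0) (ha : a ≠ 0) {N : ℕ}
    (h1 : qPoch (q / a) q (2 * N) ≠ 0) (h2 : qPoch (q / (q ^ (2 * N + 1) / a)) q N ≠ 0)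
    (h3 : qPoch (q / (q ^ (2 * N + 1))⁻¹) q N ≠ 0) (h4 : qPoch (-q) q N ≠ 0) :
    ∑ k ∈ Finset.range (N + 1), tripleTerm q a (q ^ (2 * N + 1) / a) (q ^ (2 * N + 1))⁻¹ k =
      qInt q (2 * N + 1) * qPoch q q (2 * N) / ((a * q) ^ N * qPoch (q / a) q (2 * N)) := by
  have hw : q ^ (2 * N + 1) ≠ 0 := pow_ne_zero _ hq
  let φ : ℤ[X][X] →+* K := (aevalAeval q a : ℤ[X][X] →ₐ[ℤ] K)
  let Q : FractionRing ℤ[X][X] := algebraMap ℤ[X][X] _ (C X)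
  let B : FractionRing ℤ[X][X] := algebraMap ℤ[X][X] _ X
  have hQ : SpecializesTo φ Q q := by
    simpa [φ] using SpecializesTo.of_algebraMap (K := FractionRing ℤ[X][X]) φ (C X)
  have hB : SpecializesTo φ B a := by
    simpa [φ] using SpecializesTo.of_algebraMap (K := FractionRing ℤ[X][X]) φ X
  have hinj := IsFractionRing.injective ℤ[X][X] (FractionRing ℤ[X][X])
  have hgeneric : ∑ k ∈ Finset.range (N + 1),
        tripleTerm Q B (Q ^ (2 * N + 1) / B) (Q ^ (2 * N + 1))⁻¹ k =
      qInt Q (2 * N + 1) * qPoch Q Q (2 * N) / ((B * Q) ^ N * qPoch (Q / B) Q (2 * N)) := by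
    refine sum_tripleTerm_of_generic ?_ (fun i hi h => ?_) ?_ (fun i j h => ?_) N
    · exact (map_ne_zero_iff _ hinj).2 (C_ne_zero.2 X_ne_zero)
    · have h' : (C (X ^ i) : ℤ[X][X]) = C 1 := hinj (by simpa [Q] using h)
      simpa [hi.ne'] using congrArg natDegree (C_injective h')
    · exact (map_ne_zero_iff _ hinj).2 (X_ne_zero (R := ℤ[X]))
    · have h' : (X * C (X ^ i) : ℤ[X][X]) = C (X ^ j) := hinj (by simpa [Q, B] using h)
      simpa [natDegree_X_mul] using congrArg natDegree h'
  have hsum := SpecializesTo.sum (φ := φ) (s := Finset.range (N + 1)) fun k hk =>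
    have hkN : k ≤ N := Nat.lt_succ_iff.1 (Finset.mem_range.1 hk)
    hQ.tripleTerm hB ((hQ.pow (2 * N + 1)).div hB ha) ((hQ.pow (2 * N + 1)).inv hw) hq ha
      (div_ne_zero hw ha) (inv_ne_zero hw) (qPoch_ne_zero_of_le (by omega) h1)
      (qPoch_ne_zero_of_le hkN h2) (qPoch_ne_zero_of_le hkN h3) (qPoch_ne_zero_of_le hkN h4)
  rw [hgeneric] at hsum
  exact hsum.unique <| ((hQ.qInt _).mul (hQ.qPoch hQ _)).div
    (((hB.mul hQ).pow N).mul ((hQ.div hB ha).qPoch hQ _))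
    (mul_ne_zero (pow_ne_zero _ (mul_ne_zero ha hq)) h1)

end Transfer

section SpecialCases

variable {K : Type*} [Field K]

lemma cTermParam_eq_tripleTerm (a q : K) (k : ℕ) :
    cTermParam a q k = tripleTerm q a a⁻¹ 1 k := by
  rw [cTermParam, tripleTerm, tripleCoeff, qPoch_sq_sq, one_mul, div_one, div_inv_eq_mul,
    ← mul_assoc, mul_comm q a, mul_comm (qPoch (a * q) q k), div_eq_inv_mul q a]

lemma cTermParam_one (q : K) : cTermParam 1 q = cTerm q := by
  funext k
  simp only [cTermParam, cTerm, one_mul, div_one, pow_succ, pow_zero]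

lemma cTermParam_inv (a q : K) : cTermParam a⁻¹ q = cTermParam a q := by
  funext k
  rw [cTermParam, cTermParam, div_inv_eq_mul, ← div_eq_inv_mul, mul_comm q a,
    mul_comm (qPoch (q / a) (q ^ 2) k), mul_comm (qPoch (q / a) q k)]

lemma tripleTerm_rotate (q a b c : K) (k : ℕ) : tripleTerm q a b c k = tripleTerm q c a b k := by
  rw [tripleTerm, tripleTerm, tripleCoeff, tripleCoeff]
  congr 2 <;> ring

lemma cTermParam_pow_eq_zero {q : K} (hq : q ≠ 0) {N k : ℕ} (hk : N < k) :
    cTermParam (q ^ (2 * N + 1)) q k = 0 := by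
  have h : q / q ^ (2 * N + 1) * (q ^ 2) ^ N = 1 := by
    rw [div_mul_eq_mul_div, ← pow_mul, ← pow_succ', div_self (pow_ne_zero _ hq)]
  rw [cTermParam, qPoch_eq_zero hk h]
  simp

lemma cTermParam_eq_zero_of_pow_eq_one (a : K) {q : K} {N k : ℕ} (hk : N < k)
    (hq : q ^ (2 * N + 1) = 1) : cTermParam a q k = 0 := by
  rw [cTermParam, qPoch_eq_zero (a := q) hk (by rw [← pow_mul, ← pow_succ', hq])]
  simp

lemma sum_cTermParam_pow {q : K} (hq : q ≠ 0) (hq1 : ∀ i, 0 < i → q ^ i ≠ 1) (N : ℕ) :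
    ∑ k ∈ Finset.range (N + 1), cTermParam (q ^ (2 * N + 1)) q k = qInt q (2 * N + 1) / q ^ N := by
  have hqq (k : ℕ) : qPoch q q k ≠ 0 :=
    qPoch_ne_zero fun i _ h => hq1 (i + 1) (by omega) (by rw [pow_succ', h])
  have h := sum_tripleTerm (N := N) hq (one_ne_zero (α := K)) (by rw [div_one]; exact hqq _)
    (qPoch_ne_zero fun i hi h => hq1 (2 * N - i) (by omega) ?_)
    (qPoch_ne_zero fun i _ h => hq1 (2 * N + 2 + i) (by omega) ?_)
    (qPoch_ne_zero fun i _ h => hq1 (2 * (i + 1)) (by omega) ?_)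
  · rw [one_mul, div_one, div_one, mul_div_mul_right _ _ (hqq _)] at h
    rw [← h]
    refine Finset.sum_congr rfl fun k _ => ?_
    rw [cTermParam_eq_tripleTerm, tripleTerm_rotate]
  · rw [div_one, div_mul_eq_mul_div, div_eq_one_iff_eq (pow_ne_zero _ hq), ← pow_succ'] at h
    apply mul_right_cancel₀ (pow_ne_zero (i + 1) hq)
    rw [one_mul, ← pow_add, h]
    congr 1
    omega
  · rw [← h, div_inv_eq_mul, ← pow_succ', ← pow_add]
  · rw [mul_comm, pow_mul, pow_succ' _ i, ← neg_sq, ← neg_mul, h, one_pow]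

lemma qPoch_mul_ne_zero_of_isPrimitiveRoot {x ζ : K} {d r : ℕ} (hζ : IsPrimitiveRoot ζ d)
    (hx : x ^ d = 1 → x = 1) (hr : r < d) : qPoch (x * ζ) ζ r ≠ 0 := by
  refine qPoch_ne_zero fun i hi h => ?_
  rw [mul_assoc, ← pow_succ'] at h
  have hxd : x ^ d = 1 := by
    have hpow := congrArg (· ^ d) h
    simpa only [mul_pow, pow_right_comm, hζ.pow_eq_one, one_pow, mul_one] using hpow
  rw [hx hxd, one_mul] at h
  exact hζ.pow_ne_one_of_pos_of_lt i.succ_ne_zero (by omega) h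

lemma qPoch_neg_ne_zero_of_odd [NeZero (2 : K)] {ζ : K} {d : ℕ} (hζ : ζ ^ d = 1) (hd : Odd d)
    (k : ℕ) : qPoch (-ζ) ζ k ≠ 0 := by
  refine qPoch_ne_zero fun i _ h => two_ne_zero (α := K) ?_
  have hpow := congrArg (· ^ d) h
  simp only [neg_mul, ← pow_succ', hd.neg_pow, pow_right_comm, hζ, one_pow] at hpow
  linear_combination -hpow

lemma sum_cTermParam_of_isPrimitiveRoot [NeZero (2 : K)] {a ζ : K} {N : ℕ}
    (hζ : IsPrimitiveRoot ζ (2 * N + 1)) (hN : 0 < N) (ha : a ≠ 0)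
    (ha1 : a ^ (2 * N + 1) = 1 → a = 1) :
    ∑ k ∈ Finset.range (2 * N + 1), cTermParam a ζ k = 0 := by
  have h := sum_tripleTerm (N := N) (hζ.ne_zero (by omega)) ha
    (by
      rw [div_eq_inv_mul]
      exact qPoch_mul_ne_zero_of_isPrimitiveRoot hζ (by simpa using ha1) (by omega))
    (by
      rw [hζ.pow_eq_one, one_div, div_inv_eq_mul, mul_comm]
      exact qPoch_mul_ne_zero_of_isPrimitiveRoot hζ ha1 (by omega))
    (by
      rw [hζ.pow_eq_one, inv_one, div_one]
      simpa only [one_mul] using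
        qPoch_mul_ne_zero_of_isPrimitiveRoot (x := 1) (r := N) hζ (fun _ => rfl) (by omega))
    (qPoch_neg_ne_zero_of_odd hζ.pow_eq_one (odd_two_mul_add_one N) N)
  rw [qInt_eq_zero (hζ.ne_one (by omega)) hζ.pow_eq_one, zero_mul, zero_div, hζ.pow_eq_one,
    one_div, inv_one] at h
  rw [two_mul, add_right_comm, Finset.sum_range_add, Finset.sum_congr rfl fun k _ =>
    cTermParam_eq_tripleTerm a ζ k, h, zero_add]
  exact Finset.sum_eq_zero fun k _ =>
    cTermParam_eq_zero_of_pow_eq_one a (by omega) hζ.pow_eq_one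

end SpecialCases

section TruncatedSquare

variable {K : Type*} [Field K]

lemma truncSquare_eq_sum_mul_sum (c : ℕ → K) (n : ℕ) :
    truncSquare c n = ∑ j ∈ Finset.range n, c j * ∑ l ∈ Finset.range (n - j), c l := by
  rw [truncSquare, Finset.sum_range_diag_flip n fun i j => c i * c j]
  simp only [Finset.mul_sum]

lemma sum_range_eq_of_eq_zero {M : Type*} [AddCommMonoid M] {c : ℕ → M} {m n : ℕ} (hmn : m ≤ n)
    (hc : ∀ k, m ≤ k → k < n → c k = 0) :
    ∑ k ∈ Finset.range n, c k = ∑ k ∈ Finset.range m, c k := by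
  rw [← Finset.sum_range_add_sum_Ico c hmn, Finset.sum_eq_zero fun k hk =>
    hc k (Finset.mem_Ico.1 hk).1 (Finset.mem_Ico.1 hk).2, add_zero]

lemma truncSquare_eq_sq {c : ℕ → K} {N : ℕ} (hc : ∀ k, N < k → c k = 0) :
    truncSquare c (2 * N + 1) = (∑ k ∈ Finset.range (N + 1), c k) ^ 2 := by
  rw [truncSquare_eq_sum_mul_sum, sum_range_eq_of_eq_zero (m := N + 1) (by omega)
    fun k hk _ => by rw [hc k hk, zero_mul], sq, Finset.sum_mul]
  refine Finset.sum_congr rfl fun j hj => ?_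
  rw [Finset.mem_range] at hj
  rw [sum_range_eq_of_eq_zero (m := N + 1) (by omega) fun k hk _ => hc k hk]

section BlockSequence

variable {c β γ : ℕ → K} {N : ℕ}
  (hc : ∀ t r, r < 2 * N + 1 → c ((2 * N + 1) * t + r) = β t * γ r)
  (hγ : ∀ r, N < r → γ r = 0) (hsum : ∑ r ∈ Finset.range (2 * N + 1), γ r = 0)

include hc hγ hsum

lemma sum_range_eq_zero_of_blocks (t : ℕ) {r : ℕ} (hNr : N < r) (hr : r ≤ 2 * N + 1) :
    ∑ k ∈ Finset.range ((2 * N + 1) * t + r), c k = 0 := by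
  have hblock (t : ℕ) {r : ℕ} (hNr : N < r) (hr : r ≤ 2 * N + 1) :
      ∑ i ∈ Finset.range r, c ((2 * N + 1) * t + i) = 0 := by
    rw [Finset.sum_congr rfl fun i hi => hc t i ((Finset.mem_range.1 hi).trans_le hr),
      ← Finset.mul_sum, ← sum_range_eq_of_eq_zero hr fun k hk _ => hγ k (by omega), hsum, mul_zero]
  have hfull : ∑ k ∈ Finset.range ((2 * N + 1) * t), c k = 0 := by
    induction t with
    | zero => simp
    | succ t ih => rw [Nat.mul_succ, Finset.sum_range_add, ih, hblock t (by omega) le_rfl, add_zero]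
  rw [Finset.sum_range_add, hfull, hblock t hNr hr, add_zero]

lemma truncSquare_eq_zero_of_blocks (m : ℕ) : truncSquare c ((2 * N + 1) * m) = 0 := by
  rw [truncSquare_eq_sum_mul_sum]
  refine Finset.sum_eq_zero fun j hj => ?_
  have ht : j / (2 * N + 1) < m := Nat.div_lt_of_lt_mul (Finset.mem_range.1 hj)
  have hr : j % (2 * N + 1) < 2 * N + 1 := Nat.mod_lt _ (by omega)
  rw [← Nat.div_add_mod j (2 * N + 1)]
  generalize j / (2 * N + 1) = t, j % (2 * N + 1) = r at *
  rcases lt_or_ge N r with hNr | hNr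
  · rw [hc t r hr, hγ r hNr, mul_zero, zero_mul]
  · obtain ⟨s, rfl⟩ := Nat.exists_eq_add_of_lt ht
    rw [show (2 * N + 1) * (t + s + 1) - ((2 * N + 1) * t + r) =
        (2 * N + 1) * s + (2 * N + 1 - r) by
      rw [add_assoc, mul_add, mul_add, mul_one]; omega,
      sum_range_eq_zero_of_blocks hc hγ hsum s (by omega) (by omega), mul_zero]

end BlockSequence

end TruncatedSquare

section BlockSpecialization

variable {A K L : Type*} [CommRing A] [Field K] [Algebra A K] [Field L] {φ : A →+* L}

/-- The sequence `c` specializes on each block of `d` consecutive indices to a multiple of the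
values of `γ` at the indices below `d`. -/
def BlockSpecializesTo (φ : A →+* L) (d : ℕ) (c : ℕ → K) (γ : ℕ → L) : Prop :=
  ∃ β : ℕ → L, ∀ t r, r < d → SpecializesTo φ (c (d * t + r)) (β t * γ r)

/-- The quotient `(xq;q²)_k / (xq;q)_k`. Its values at `x = a, a⁻¹, 1` are the building blocks of
`c_{a,q}(k)`. -/
def pochRatio {F : Type*} [Field F] (x q : F) (k : ℕ) : F :=
  qPoch (x * q) (q ^ 2) k / qPoch (x * q) q k

lemma cTermParam_eq_pochRatio {F : Type*} [Field F] (a q : F) :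
    cTermParam a q = fun k => qInt q (3 * k + 1) * pochRatio a q k * pochRatio a⁻¹ q k *
      pochRatio 1 q k * q ^ (-((k + 1).choose 2 : ℤ)) * (qPoch (-q) q k)⁻¹ := by
  funext k
  rw [cTermParam, qPoch_sq_sq, div_eq_inv_mul q a, pochRatio, pochRatio, pochRatio, one_mul]
  simp only [div_eq_mul_inv, mul_inv]
  ring

lemma pochRatio_add {F : Type*} [Field F] (x q : F) (m k : ℕ) :
    pochRatio x q (m + k) = pochRatio x q m *
      (qPoch (x * q * (q ^ 2) ^ m) (q ^ 2) k / qPoch (x * q * q ^ m) q k) := by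
  rw [pochRatio, qPoch_add, qPoch_add, mul_div_mul_comm, pochRatio]

lemma pochRatio_add_period {F : Type*} [Field F] (x q : F) (N t : ℕ) :
    pochRatio x q ((2 * N + 1) * (t + 1)) = pochRatio x q ((2 * N + 1) * t) *
      ((1 - x * q ^ ((2 * N + 1) * (2 * t + 1))) / (1 - x * q ^ ((2 * N + 1) * (t + 1))) *
        (qPoch (x * q * (q ^ 2) ^ ((2 * N + 1) * t)) (q ^ 2) N *
            qPoch (x * q * (q ^ 2) ^ ((2 * N + 1) * t) * (q ^ 2) ^ (N + 1)) (q ^ 2) N /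
          qPoch (x * q * q ^ ((2 * N + 1) * t)) q (2 * N))) := by
  have hnum : qPoch (x * q * (q ^ 2) ^ ((2 * N + 1) * t)) (q ^ 2) (N + 1 + N) =
      (1 - x * q ^ ((2 * N + 1) * (2 * t + 1))) *
        (qPoch (x * q * (q ^ 2) ^ ((2 * N + 1) * t)) (q ^ 2) N *
          qPoch (x * q * (q ^ 2) ^ ((2 * N + 1) * t) * (q ^ 2) ^ (N + 1)) (q ^ 2) N) := by
    rw [qPoch_add, qPoch_succ]
    ring
  have hden : qPoch (x * q * q ^ ((2 * N + 1) * t)) q (2 * N + 1) =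
      (1 - x * q ^ ((2 * N + 1) * (t + 1))) *
        qPoch (x * q * q ^ ((2 * N + 1) * t)) q (2 * N) := by
    rw [qPoch_succ]
    ring
  rw [div_mul_div_comm, ← hden, ← hnum, Nat.mul_succ, pochRatio_add, add_right_comm, ← two_mul]

lemma choose_two_add (m n : ℕ) : (m + n).choose 2 = m.choose 2 + m * n + n.choose 2 := by
  induction n with
  | zero => simp
  | succ n ih =>
    rw [← add_assoc, Nat.choose_succ_succ' (m + n) 1, Nat.choose_succ_succ' n 1,
      Nat.choose_one_right, Nat.choose_one_right, ih]
    ring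

namespace BlockSpecializesTo

variable {d : ℕ} {b c : ℕ → K} {γ δ : ℕ → L}

lemma mul (hb : BlockSpecializesTo φ d b γ) (hc : BlockSpecializesTo φ d c δ) :
    BlockSpecializesTo φ d (fun k => b k * c k) fun r => γ r * δ r := by
  obtain ⟨β, hβ⟩ := hb
  obtain ⟨β', hβ'⟩ := hc
  refine ⟨fun t => β t * β' t, fun t r hr => ?_⟩
  rw [mul_mul_mul_comm]
  exact (hβ t r hr).mul (hβ' t r hr)

lemma of_specializesTo {β : ℕ → L} (hc : ∀ k, SpecializesTo φ (c k) (γ k))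
    (hγ : ∀ t r, γ (d * t + r) = β t * γ r) : BlockSpecializesTo φ d c γ :=
  ⟨β, fun t r _ => hγ t r ▸ hc _⟩

lemma truncSquare {N : ℕ} (hc : BlockSpecializesTo φ (2 * N + 1) c γ) (hγ : ∀ r, N < r → γ r = 0)
    (hsum : ∑ r ∈ Finset.range (2 * N + 1), γ r = 0) (m : ℕ) :
    SpecializesTo φ (truncSquare c ((2 * N + 1) * m)) 0 := by
  obtain ⟨β, hβ⟩ := hc
  have hmod (k : ℕ) : k % (2 * N + 1) < 2 * N + 1 := Nat.mod_lt k (by omega)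
  rw [← truncSquare_eq_zero_of_blocks (β := β) (γ := γ)
    (c := fun k => β (k / (2 * N + 1)) * γ (k % (2 * N + 1))) (fun t r hr => ?_) hγ hsum m]
  · refine SpecializesTo.truncSquare fun k _ => ?_
    simpa only [Nat.div_add_mod] using hβ (k / (2 * N + 1)) _ (hmod k)
  · rw [Nat.mul_add_div (by omega), Nat.div_eq_of_lt hr, add_zero, Nat.mul_add_mod,
      Nat.mod_eq_of_lt hr]

variable {q x : K} {ζ ξ : L}

lemma qInt (hq : SpecializesTo φ q ζ) (hζ : ζ ^ d = 1) (hζ1 : ζ ≠ 1) :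
    BlockSpecializesTo φ d (fun k => qInt q (3 * k + 1)) fun r => _root_.qInt ζ (3 * r + 1) :=
  of_specializesTo (β := 1) (fun k => hq.qInt _) fun t r => by
    apply mul_left_cancel₀ (sub_ne_zero.2 hζ1.symm)
    rw [Pi.one_apply, one_mul, one_sub_mul_qInt, one_sub_mul_qInt,
      show 3 * (d * t + r) + 1 = d * (3 * t) + (3 * r + 1) by ring, pow_add, pow_mul, hζ, one_pow,
      one_mul]

variable [IsFractionRing A K]

lemma qPoch_neg_inv [NeZero (2 : L)] (hq : SpecializesTo φ q ζ) (hζ : ζ ^ d = 1) (hd : Odd d) :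
    BlockSpecializesTo φ d (fun k => (qPoch (-q) q k)⁻¹) fun r => (qPoch (-ζ) ζ r)⁻¹ :=
  of_specializesTo (β := fun t => (qPoch (-ζ) ζ (d * t))⁻¹)
    (fun k => (hq.neg.qPoch hq k).inv (qPoch_neg_ne_zero_of_odd hζ hd k)) fun t r => by
      rw [qPoch_add, pow_mul, hζ, one_pow, mul_one, mul_inv]

lemma zpow_neg_choose (hq : SpecializesTo φ q ζ) (hζ : ζ ^ d = 1) (hζ0 : ζ ≠ 0) :
    BlockSpecializesTo φ d (fun k => q ^ (-((k + 1).choose 2 : ℤ)))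
      fun r => ζ ^ (-((r + 1).choose 2 : ℤ)) :=
  of_specializesTo (β := fun t => ζ ^ (-((d * t).choose 2 : ℤ))) (fun k => hq.zpow hζ0 _)
    fun t r => by
      rw [add_assoc, choose_two_add, mul_assoc]
      push_cast
      rw [neg_add_rev, neg_add_rev, zpow_add₀ hζ0, zpow_add₀ hζ0, zpow_neg ζ (d * _), zpow_mul,
        zpow_natCast, hζ, one_zpow, inv_one, one_mul, mul_comm]

lemma pochRatio {N : ℕ} (hx : SpecializesTo φ x ξ) (hq : SpecializesTo φ q ζ)
    (hζ : IsPrimitiveRoot ζ (2 * N + 1)) (hξ : ξ ^ (2 * N + 1) = 1 → ξ = 1)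
    (hratio : ∀ t, ∃ v, SpecializesTo φ
      ((1 - x * q ^ ((2 * N + 1) * (2 * t + 1))) / (1 - x * q ^ ((2 * N + 1) * (t + 1)))) v) :
    BlockSpecializesTo φ (2 * N + 1) (pochRatio x q) (pochRatio ξ ζ) := by
  have hpow (m : ℕ) : ζ ^ ((2 * N + 1) * m) = 1 := by rw [pow_mul, hζ.pow_eq_one, one_pow]
  have hspec {y : K} (hy : SpecializesTo φ y 1) : SpecializesTo φ (x * q * y) (ξ * ζ) := by
    simpa only [mul_one] using (hx.mul hq).mul hy
  have hfst (t : ℕ) : SpecializesTo φ (x * q * q ^ ((2 * N + 1) * t)) (ξ * ζ) :=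
    hspec (by simpa only [hpow] using hq.pow ((2 * N + 1) * t))
  have hsnd (t : ℕ) : SpecializesTo φ (x * q * (q ^ 2) ^ ((2 * N + 1) * t)) (ξ * ζ) :=
    hspec (by
      simpa only [pow_right_comm ζ 2, hpow, one_pow] using (hq.pow 2).pow ((2 * N + 1) * t))
  have htail (t : ℕ) {r : ℕ} (hr : r < 2 * N + 1) := ((hsnd t).qPoch (hq.pow 2) r).div
    ((hfst t).qPoch hq r) (qPoch_mul_ne_zero_of_isPrimitiveRoot hζ hξ hr)
  have hstart (t : ℕ) : ∃ β, SpecializesTo φ (_root_.pochRatio x q ((2 * N + 1) * t)) β := by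
    induction t with
    | zero => exact ⟨1, by simpa [_root_.pochRatio] using SpecializesTo.one φ⟩
    | succ t ih =>
      obtain ⟨β, hβ⟩ := ih
      obtain ⟨v, hv⟩ := hratio t
      have hblock := (((hsnd t).qPoch (hq.pow 2) N).mul
        (((hsnd t).mul ((hq.pow 2).pow (N + 1))).qPoch (hq.pow 2) N)).div
          ((hfst t).qPoch hq (2 * N)) (qPoch_mul_ne_zero_of_isPrimitiveRoot hζ hξ (by omega))
      exact ⟨_, pochRatio_add_period x q N t ▸ hβ.mul (hv.mul hblock)⟩
  choose β hβ using hstart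
  exact ⟨β, fun t r hr => by rw [pochRatio_add]; exact (hβ t).mul (htail t hr)⟩

lemma pochRatio_of_pow_ne_one {N : ℕ} (hx : SpecializesTo φ x ξ) (hq : SpecializesTo φ q ζ)
    (hζ : IsPrimitiveRoot ζ (2 * N + 1)) (hξ : ξ ^ (2 * N + 1) ≠ 1) :
    BlockSpecializesTo φ (2 * N + 1) (_root_.pochRatio x q) (_root_.pochRatio ξ ζ) := by
  have hspec (m : ℕ) : SpecializesTo φ (1 - x * q ^ ((2 * N + 1) * m)) (1 - ξ) := by
    simpa only [pow_mul, hζ.pow_eq_one, one_pow, mul_one] using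
      (SpecializesTo.one φ).sub (hx.mul (hq.pow ((2 * N + 1) * m)))
  have hξ1 : 1 - ξ ≠ 0 := sub_ne_zero.2 fun h => hξ (by rw [← h, one_pow])
  exact pochRatio hx hq hζ (fun h => absurd h hξ) fun t => ⟨_, (hspec _).div (hspec _) hξ1⟩

lemma pochRatio_one [CharZero L] {N : ℕ} (hq : SpecializesTo φ q ζ)
    (hζ : IsPrimitiveRoot ζ (2 * N + 1)) (hq1 : q ^ (2 * N + 1) ≠ 1) :
    BlockSpecializesTo φ (2 * N + 1) (_root_.pochRatio 1 q) (_root_.pochRatio 1 ζ) := by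
  refine pochRatio (SpecializesTo.one φ) hq hζ (fun _ => rfl) fun t => ?_
  have hspec (m : ℕ) := (hq.pow (2 * N + 1)).qInt m
  simp only [one_mul, pow_mul q, ← one_sub_mul_qInt (q ^ (2 * N + 1)),
    mul_div_mul_left _ _ (sub_ne_zero.2 hq1.symm)]
  exact ⟨_, (hspec _).div (hspec _) (by
    simp [hζ.pow_eq_one, _root_.qInt, Nat.cast_add_one_ne_zero])⟩

lemma cTermParam [CharZero L] {a : K} {α : L} {N : ℕ} (ha : SpecializesTo φ a α)
    (hq : SpecializesTo φ q ζ) (hζ : IsPrimitiveRoot ζ (2 * N + 1)) (hN : 0 < N)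
    (hq1 : q ^ (2 * N + 1) ≠ 1) (hα : α ≠ 0) (h : a = 1 ∨ α ^ (2 * N + 1) ≠ 1) :
    BlockSpecializesTo φ (2 * N + 1) (cTermParam a q) (cTermParam α ζ) := by
  have hζ1 := hζ.pow_eq_one
  have hone := pochRatio_one hq hζ hq1
  have hpoch : BlockSpecializesTo φ (2 * N + 1) (_root_.pochRatio a q) (_root_.pochRatio α ζ) ∧
      BlockSpecializesTo φ (2 * N + 1) (_root_.pochRatio a⁻¹ q) (_root_.pochRatio α⁻¹ ζ) := by
    rcases h with rfl | h
    · obtain rfl : α = 1 := ha.unique (SpecializesTo.one φ)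
      exact ⟨hone, by simpa only [inv_one] using hone⟩
    · exact ⟨pochRatio_of_pow_ne_one ha hq hζ h, pochRatio_of_pow_ne_one (ha.inv hα) hq hζ
        (by rwa [inv_pow, Ne, inv_eq_one])⟩
  rw [cTermParam_eq_pochRatio, cTermParam_eq_pochRatio]
  exact (((((qInt hq hζ1 (hζ.ne_one (by omega))).mul hpoch.1).mul hpoch.2).mul hone).mul
    (zpow_neg_choose hq hζ1 (hζ.ne_zero (by omega)))).mul
      (qPoch_neg_inv hq hζ1 (odd_two_mul_add_one N))

end BlockSpecializesTo

lemma SpecializesTo.truncSquare_cTermParam [IsFractionRing A K] [CharZero L] {a q : K} {α ζ : L}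
    {N : ℕ} (ha : SpecializesTo φ a α) (hq : SpecializesTo φ q ζ)
    (hζ : IsPrimitiveRoot ζ (2 * N + 1)) (hN : 0 < N) (hq1 : q ^ (2 * N + 1) ≠ 1) (hα : α ≠ 0)
    (h : a = 1 ∨ α ^ (2 * N + 1) ≠ 1) (m : ℕ) :
    SpecializesTo φ (_root_.truncSquare (cTermParam a q) ((2 * N + 1) * m)) 0 := by
  refine (BlockSpecializesTo.cTermParam ha hq hζ hN hq1 hα h).truncSquare
    (fun r hr => cTermParam_eq_zero_of_pow_eq_one α hr hζ.pow_eq_one)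
    (sum_cTermParam_of_isPrimitiveRoot hζ hN hα fun hα1 => ?_) m
  rcases h with rfl | h
  · exact ha.unique (SpecializesTo.one φ)
  · exact absurd hα1 h

end BlockSpecialization

section Congruence

variable {A K : Type*} [CommRing A] [IsDomain A] [UniqueFactorizationMonoid A] [Field K]
  [Algebra A K] [IsFractionRing A K] {P Q : A} {f g h : K}

lemma ratCongr_iff :
    RatCongr P f g ↔ ∀ U V : A, (f - g) * algebraMap A K V = algebraMap A K U → P ∣ U := by
  have hinj := IsFractionRing.injective A K
  constructor
  · rintro ⟨N, D, hD, hDP, hfg⟩ U V hUV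
    rw [hfg, div_mul_eq_mul_div, div_eq_iff ((map_ne_zero_iff _ hinj).2 hD), ← map_mul,
      ← map_mul, hinj.eq_iff, mul_assoc] at hUV
    exact hDP.symm.dvd_of_dvd_mul_right (Dvd.intro _ hUV)
  · intro hdvd
    obtain ⟨U, V, hUV, hfg⟩ := IsFractionRing.exists_reduced_fraction A (f - g)
    rw [IsFractionRing.mk'_eq_div] at hfg
    have hV : (V : A) ≠ 0 := nonZeroDivisors.ne_zero V.2
    obtain ⟨N, rfl⟩ := hdvd U V (by
      rw [← hfg, div_mul_cancel₀ _ ((map_ne_zero_iff _ hinj).2 hV)])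
    exact ⟨N, V, hV, hUV.symm.of_mul_right_left, hfg.symm⟩

namespace RatCongr

lemma trans (hfg : RatCongr P f g) (hgh : RatCongr P g h) : RatCongr P f h := by
  obtain ⟨N, D, hD, hDP, hfg⟩ := hfg
  obtain ⟨N', D', hD', hDP', hgh⟩ := hgh
  have hinj := IsFractionRing.injective A K
  refine ⟨N * D' + N' * D, D * D', mul_ne_zero hD hD', hDP.mul_left hDP', ?_⟩
  rw [← sub_add_sub_cancel, hfg, hgh, div_add_div _ _ ((map_ne_zero_iff _ hinj).2 hD)
    ((map_ne_zero_iff _ hinj).2 hD'), ← map_mul, ← map_mul, ← map_mul, ← map_add]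
  ring_nf

lemma mul (hPQ : IsRelPrime P Q) (hP : RatCongr P f g) (hQ : RatCongr Q f g) :
    RatCongr (P * Q) f g :=
  ratCongr_iff.2 fun U V hUV => hPQ.mul_dvd (ratCongr_iff.1 hP U V hUV) (ratCongr_iff.1 hQ U V hUV)

lemma prod {ι : Type*} {s : Finset ι} {P : ι → A}
    (hs : (s : Set ι).Pairwise (Function.onFun IsRelPrime P)) (hP : ∀ i ∈ s, RatCongr (P i) f g) :
    RatCongr (∏ i ∈ s, P i) f g :=
  ratCongr_iff.2 fun U V hUV =>
    Finset.prod_dvd_of_isRelPrime hs fun i hi => ratCongr_iff.1 (hP i hi) U V hUV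

lemma map {B L : Type*} [CommRing B] [Field L] [Algebra B L] [IsFractionRing B L] {ψ : A →+* B}
    {R : B} {f' g' : L} (hfg : RatCongr P f g)
    (hf : SpecializesTo ((algebraMap B L).comp ψ) f f')
    (hg : SpecializesTo ((algebraMap B L).comp ψ) g g') (hR : R ∣ ψ P) {U V : A}
    (hUV : (f - g) * algebraMap A K V = algebraMap A K U) (hV : ψ V ≠ 0)
    (hVR : IsRelPrime (ψ V) R) : RatCongr R f' g' := by
  obtain ⟨N, hN⟩ := hR.trans (map_dvd ψ (ratCongr_iff.1 hfg U V hUV))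
  refine ⟨N, ψ V, hV, hVR, ?_⟩
  rw [← hN, eq_div_iff ((map_ne_zero_iff _ (IsFractionRing.injective B L)).2 hV)]
  exact ((hf.sub hg).map_num_eq hUV).symm

end RatCongr

lemma SpecializesTo.ratCongr {L : Type*} [Field L] {φ : A →+* L} {v : L}
    (hφ : ∀ U, φ U = 0 → P ∣ U) (hf : SpecializesTo φ f v) (hg : SpecializesTo φ g v) :
    RatCongr P f g :=
  ratCongr_iff.2 fun U V hUV => hφ U (by
    rw [(hf.sub hg).map_num_eq hUV, sub_self, zero_mul])

end Congruence

section Modulus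

lemma C_dvd_of_map_eq_zero {R S : Type*} [CommRing R] [CommRing S] {f : R →+* S} {r : R}
    (hf : ∀ x, f x = 0 → r ∣ x) {U : R[X]} (hU : U.map f = 0) : C r ∣ U :=
  (C_dvd_iff_dvd_coeff r U).2 fun i => hf _ (by rw [← coeff_map, hU, coeff_zero])

lemma isPrimitive_one_sub_X_mul_C {R : Type*} [CommRing R] (p : R) :
    (1 - X * C p).IsPrimitive := by
  intro r hr
  exact isUnit_of_dvd_one (by simpa using (C_dvd_iff_dvd_coeff r _).1 hr 0)

section AevalDvd

variable {R K : Type*} [CommRing R] [Field K] [Algebra R K] [IsFractionRing R K] {p : R}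
  {U : R[X]}

lemma X_sub_C_dvd_of_aeval_eq_zero (hU : aeval (algebraMap R K p) U = 0) : X - C p ∣ U := by
  rw [aeval_algebraMap_apply, map_eq_zero_iff _ (IsFractionRing.injective R K)] at hU
  rwa [dvd_iff_isRoot, IsRoot, ← coe_aeval_eq_eval]

lemma one_sub_X_mul_C_dvd_of_aeval_eq_zero [IsDomain R] [IsGCDMonoid R] (hp : p ≠ 0)
    (hU : aeval (algebraMap R K p)⁻¹ U = 0) : 1 - X * C p ∣ U := by
  have hp' : algebraMap R K p ≠ 0 := (map_ne_zero_iff _ (IsFractionRing.injective R K)).2 hp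
  apply (isPrimitive_one_sub_X_mul_C p).dvd_of_fraction_map_dvd_fraction_map (K := K)
  have hassoc : (1 - X * C p).map (algebraMap R K) =
      C (-algebraMap R K p) * (X - C (algebraMap R K p)⁻¹) := by
    rw [mul_sub, ← C_mul, neg_mul, mul_inv_cancel₀ hp']
    simp only [Polynomial.map_sub, Polynomial.map_one, Polynomial.map_mul, map_X,
      Polynomial.map_C, C_neg, C_1]
    ring
  rw [hassoc, (isUnit_C.2 (neg_ne_zero.2 hp').isUnit).mul_left_dvd, dvd_iff_isRoot, IsRoot,
    eval_map_algebraMap, hU]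

end AevalDvd

lemma isRelPrime_C_one_sub_X_mul_C {R : Type*} [CommRing R] [IsDomain R] {r : R}
    (hr : r ≠ 0) (p : R) :
    IsRelPrime (C r) (1 - X * C p) := by
  intro s hsr hsp
  have hs : s.natDegree = 0 := by simpa using natDegree_le_of_dvd hsr (C_ne_zero.2 hr)
  rw [eq_C_of_natDegree_eq_zero hs] at hsp ⊢
  exact isUnit_C.2 (isPrimitive_one_sub_X_mul_C p _ hsp)

lemma cyclotomic_dvd_iff_aeval_eq_zero {d : ℕ} (hd : 0 < d) {ζ : ℂ} (hζ : IsPrimitiveRoot ζ d)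
    {U : ℚ[X]} : cyclotomic d ℚ ∣ U ↔ aeval ζ U = 0 := by
  rw [cyclotomic_eq_minpoly_rat hζ hd, minpoly.dvd_iff]

lemma qInt_X_eq_prod_cyclotomic {n : ℕ} (hn : 0 < n) :
    qInt (X : ℚ[X]) n = ∏ d ∈ n.divisors.erase 1, cyclotomic d ℚ :=
  (prod_cyclotomic_eq_geom_sum hn ℚ).symm

lemma qInt_X_ne_zero {n : ℕ} (hn : 0 < n) : qInt (X : ℚ[X]) n ≠ 0 := by
  rw [qInt_X_eq_prod_cyclotomic hn]
  exact Finset.prod_ne_zero_iff.2 fun d _ => cyclotomic_ne_zero d ℚ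

lemma cyclotomic_dvd_qInt {n : ℕ} (hn : 1 < n) : cyclotomic n ℚ ∣ qInt (X : ℚ[X]) n := by
  rw [qInt_X_eq_prod_cyclotomic (by omega)]
  exact Finset.dvd_prod_of_mem _ (by simp; omega)

lemma cyclotomic_cube_dvd {n : ℕ} (hn : 1 < n) :
    cyclotomic n ℚ ^ 3 ∣ (1 - X ^ n) * qInt X n ^ 2 := by
  rw [pow_succ', ← one_sub_mul_qInt]
  have hdvd := cyclotomic_dvd_qInt hn
  exact mul_dvd_mul (hdvd.mul_left _) (pow_dvd_pow_of_dvd hdvd 2)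

lemma qInt_C (n : ℕ) : qInt (C X : ℚ[X][X]) n = C (qInt X n) := by
  simp only [qInt, map_sum, map_pow]

lemma C_qInt_X_eq_prod_cyclotomic {n : ℕ} (hn : 0 < n) :
    qInt (C X : ℚ[X][X]) n = ∏ d ∈ n.divisors.erase 1, C (cyclotomic d ℚ) := by
  rw [qInt_C, qInt_X_eq_prod_cyclotomic hn, map_prod]

end Modulus

section FinitePoint

lemma truncSquare_cTermParam_pow {K : Type*} [Field K] {q : K} (hq : q ≠ 0)
    (hq1 : ∀ i, 0 < i → q ^ i ≠ 1) {n : ℕ} (hn : Odd n) :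
    truncSquare (cTermParam (q ^ n) q) n = q ^ (1 - (n : ℤ)) * qInt q n ^ 2 := by
  obtain ⟨N, rfl⟩ := hn
  rw [truncSquare_eq_sq fun k hk => cTermParam_pow_eq_zero hq hk, sum_cTermParam_pow hq hq1,
    div_pow, ← pow_mul, mul_comm N, div_eq_inv_mul, ← zpow_natCast q (2 * N), ← zpow_neg]
  push_cast
  ring_nf

variable {A K L : Type*} [CommRing A] [Field K] [Algebra A K] [IsFractionRing A K] [Field L]

lemma SpecializesTo.truncSquare_cTermParam_of_ne {φ : A →+* L} {a q : K} {α κ : L} {n : ℕ}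
    (ha : SpecializesTo φ a α) (hq : SpecializesTo φ q κ) (hα : α ≠ 0) (hκ : κ ≠ 0)
    (hmul : ∀ i, 0 < i → i < n → α * κ ^ i ≠ 1) (hne : ∀ i, 0 < i → i < n → κ ^ i ≠ α)
    (hsq : ∀ i, 0 < i → i < n → (κ ^ 2) ^ i ≠ 1) :
    SpecializesTo φ (_root_.truncSquare (cTermParam a q) n)
      (_root_.truncSquare (cTermParam α κ) n) :=
  .truncSquare fun k hk => (hq.qInt _).mul <|
    (((((ha.mul hq).qPoch (hq.pow 2) k).mul ((hq.div ha hα).qPoch (hq.pow 2) k)).mul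
      (hq.qPoch (hq.pow 2) k)).mul (hq.zpow hκ _)).div
        ((((ha.mul hq).qPoch hq k).mul ((hq.div ha hα).qPoch hq k)).mul
          ((hq.pow 2).qPoch (hq.pow 2) k)) <|
      mul_ne_zero (mul_ne_zero
        (qPoch_ne_zero fun i hi h => hmul (i + 1) (by omega) (by omega) (by
          rw [pow_succ', ← mul_assoc, h]))
        (qPoch_ne_zero fun i hi h => hne (i + 1) (by omega) (by omega) (by
          rwa [div_mul_eq_mul_div, ← pow_succ', div_eq_one_iff_eq hα] at h)))
        (qPoch_ne_zero fun i hi h => hsq (i + 1) (by omega) (by omega) (by rw [pow_succ', h]))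

lemma zpow_ne_one_of_pow_ne_one {G : Type*} [DivisionMonoid G] {x : G}
    (hx : ∀ i : ℕ, 0 < i → x ^ i ≠ 1) {i : ℤ} (hi : i ≠ 0) : x ^ i ≠ 1 := by
  obtain ⟨m, rfl | rfl⟩ := i.eq_nat_or_neg
  · rw [zpow_natCast]
    exact hx m (by omega)
  · rw [zpow_neg, zpow_natCast, Ne, inv_eq_one]
    exact hx m (by omega)

lemma SpecializesTo.truncSquare_cTermParam_zpow {φ : A →+* L} {a q : K} {κ : L} {j : ℤ} {n : ℕ}
    (ha : SpecializesTo φ a (κ ^ j)) (hq : SpecializesTo φ q κ) (hκ0 : κ ≠ 0)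
    (hκ : ∀ i, 0 < i → κ ^ i ≠ 1) (hj : j = 0 ∨ n ≤ j.natAbs) :
    SpecializesTo φ (_root_.truncSquare (cTermParam a q) n)
      (_root_.truncSquare (cTermParam (κ ^ j) κ) n) := by
  refine ha.truncSquare_cTermParam_of_ne hq (zpow_ne_zero j hκ0) hκ0 (fun i hi hin => ?_)
    (fun i hi hin => ?_) fun i hi _ => ?_
  · rw [← zpow_natCast, ← zpow_add₀ hκ0]
    exact zpow_ne_one_of_pow_ne_one hκ (by omega)
  · rw [Ne, ← div_eq_one_iff_eq (zpow_ne_zero j hκ0), ← zpow_natCast, ← zpow_sub₀ hκ0]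
    exact zpow_ne_one_of_pow_ne_one hκ (by omega)
  · rw [← pow_mul]
    exact hκ (2 * i) (by omega)

end FinitePoint

section Parametric

lemma ratFunc_X_pow_ne_one {k : Type*} [Field k] (i : ℕ) (hi : 0 < i) :
    (RatFunc.X : RatFunc k) ^ i ≠ 1 :=
  fun h => RatFunc.transcendental_X.pow hi (h ▸ isAlgebraic_one)

variable {L : Type*} [Field L]

lemma SpecializesTo.ratFunc_X {R : Type*} [CommRing R] [IsDomain R] (φ : R[X] →+* L) :
    SpecializesTo φ (RatFunc.X : RatFunc R) (φ X) :=
  RatFunc.algebraMap_X (K := R) ▸ of_algebraMap φ X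

lemma SpecializesTo.ratFunc_C {R : Type*} [CommRing R] [IsDomain R] (φ : R[X] →+* L) (r : R) :
    SpecializesTo φ (RatFunc.C r) (φ (C r)) :=
  RatFunc.algebraMap_C r ▸ of_algebraMap φ (C r)

lemma ratCongr_truncSquare_cTermParam_C_cyclotomic {n d : ℕ} (hn : Odd n) (hdn : d ∣ n)
    (hd : 1 < d) :
    RatCongr (C (cyclotomic d ℚ))
      (truncSquare (cTermParam (RatFunc.X : RatFunc ℚ[X]) (RatFunc.C X)) n)
      (RatFunc.C X ^ (1 - (n : ℤ)) * qInt (RatFunc.C X) n ^ 2) := by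
  obtain ⟨m, rfl⟩ := hdn
  obtain ⟨N, rfl⟩ := (Nat.odd_mul.1 hn).1
  have hexp := Complex.isPrimitiveRoot_exp (2 * N + 1) (by omega)
  set ζ := Complex.exp _
  have hζ : IsPrimitiveRoot (RatFunc.C ζ : RatFunc ℂ) (2 * N + 1) :=
    hexp.map_of_injective RatFunc.C_injective
  let φ : ℚ[X][X] →+* RatFunc ℂ :=
    (algebraMap ℂ[X] (RatFunc ℂ)).comp (mapRingHom (aeval ζ : ℚ[X] →ₐ[ℚ] ℂ))
  have ha : SpecializesTo φ (RatFunc.X : RatFunc ℚ[X]) RatFunc.X := by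
    simpa [φ] using SpecializesTo.ratFunc_X φ
  have hq : SpecializesTo φ (RatFunc.C (X : ℚ[X])) (RatFunc.C ζ) := by
    simpa [φ] using SpecializesTo.ratFunc_C φ (X : ℚ[X])
  have hker (U : ℚ[X][X]) (hU : φ U = 0) : C (cyclotomic (2 * N + 1) ℚ) ∣ U :=
    C_dvd_of_map_eq_zero (fun x => (cyclotomic_dvd_iff_aeval_eq_zero (by omega) hexp).2)
      (RatFunc.algebraMap_injective ℂ (hU.trans (map_zero _).symm))
  refine SpecializesTo.ratCongr hker (ha.truncSquare_cTermParam hq hζ (by omega) ?_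
    RatFunc.X_ne_zero (.inr ?_) m) ?_
  · rw [← map_pow, ← map_one RatFunc.C, RatFunc.C_injective.ne_iff]
    exact fun h => by simpa using congrArg natDegree h
  · exact ratFunc_X_pow_ne_one _ (by omega)
  · have hζm : (RatFunc.C ζ : RatFunc ℂ) ^ ((2 * N + 1) * m) = 1 := by
      rw [pow_mul, hζ.pow_eq_one, one_pow]
    have hrhs := (hq.zpow (hζ.ne_zero (by omega)) (1 - (((2 * N + 1) * m : ℕ) : ℤ))).mul
      ((hq.qInt ((2 * N + 1) * m)).pow 2)
    rwa [qInt_eq_zero (hζ.ne_one hd) hζm, zero_pow two_ne_zero, mul_zero] at hrhs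

lemma ratCongr_truncSquare_cTermParam_of_aeval_zpow {P : ℚ[X][X]} {j : ℤ} {n : ℕ} (hn : Odd n)
    (hj : j = n ∨ j = -n) (hP : ∀ U : ℚ[X][X], aeval ((RatFunc.X : RatFunc ℚ) ^ j) U = 0 → P ∣ U) :
    RatCongr P (truncSquare (cTermParam (RatFunc.X : RatFunc ℚ[X]) (RatFunc.C X)) n)
      (RatFunc.C X ^ (1 - (n : ℤ)) * qInt (RatFunc.C X) n ^ 2) := by
  let φ : ℚ[X][X] →+* RatFunc ℚ :=
    (aeval ((RatFunc.X : RatFunc ℚ) ^ j) : ℚ[X][X] →ₐ[ℚ[X]] RatFunc ℚ)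
  have ha : SpecializesTo φ (RatFunc.X : RatFunc ℚ[X]) (RatFunc.X ^ j) := by
    simpa [φ] using SpecializesTo.ratFunc_X φ
  have hq : SpecializesTo φ (RatFunc.C (X : ℚ[X])) RatFunc.X := by
    simpa [φ] using SpecializesTo.ratFunc_C φ (X : ℚ[X])
  have hvalue : truncSquare (cTermParam (RatFunc.X ^ j) RatFunc.X) n =
      (RatFunc.X : RatFunc ℚ) ^ (1 - (n : ℤ)) * qInt RatFunc.X n ^ 2 := by
    rw [← truncSquare_cTermParam_pow RatFunc.X_ne_zero ratFunc_X_pow_ne_one hn]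
    rcases hj with rfl | rfl
    · rw [zpow_natCast]
    · rw [zpow_neg, zpow_natCast, cTermParam_inv]
  refine SpecializesTo.ratCongr hP (ha.truncSquare_cTermParam_zpow hq RatFunc.X_ne_zero
    ratFunc_X_pow_ne_one (.inr (by omega))) ?_
  rw [hvalue]
  exact (hq.zpow RatFunc.X_ne_zero _).mul ((hq.qInt n).pow 2)

lemma ratCongr_truncSquare_cTermParam_qInt {n : ℕ} (hn : Odd n) :
    RatCongr (qInt (C X : ℚ[X][X]) n)
      (truncSquare (cTermParam (RatFunc.X : RatFunc ℚ[X]) (RatFunc.C X)) n)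
      (RatFunc.C X ^ (1 - (n : ℤ)) * qInt (RatFunc.C X) n ^ 2) := by
  rw [C_qInt_X_eq_prod_cyclotomic hn.pos]
  refine RatCongr.prod (fun d _ e _ hde => ?_) fun d hd => ?_
  · exact ((cyclotomic.isCoprime_rat hde).map C).isRelPrime
  · rw [Finset.mem_erase, Nat.mem_divisors] at hd
    have hd0 := Nat.pos_of_dvd_of_pos hd.2.1 hn.pos
    exact ratCongr_truncSquare_cTermParam_C_cyclotomic hn hd.2.1 (by omega)

theorem ratCongr_truncSquare_cTermParam {n : ℕ} (hn : Odd n) :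
    RatCongr (qInt (C X : ℚ[X][X]) n * (1 - X * C X ^ n) * (X - C X ^ n))
      (truncSquare (cTermParam (RatFunc.X : RatFunc ℚ[X]) (RatFunc.C X)) n)
      (RatFunc.C X ^ (1 - (n : ℤ)) * qInt (RatFunc.C X) n ^ 2) := by
  have hqn : algebraMap ℚ[X] (RatFunc ℚ) (X ^ n) = RatFunc.X ^ n := by
    rw [map_pow, RatFunc.algebraMap_X]
  have hqInt : qInt (X : ℚ[X]) n ≠ 0 := qInt_X_ne_zero hn.pos
  rw [qInt_C, ← C_pow]
  have hcoprime : IsRelPrime (C (qInt (X : ℚ[X]) n) * (1 - X * C (X ^ n))) (X - C (X ^ n)) := by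
    refine ((prime_X_sub_C _).irreducible.isRelPrime_iff_not_dvd.2 ?_).symm
    rw [dvd_iff_isRoot, IsRoot, eval_mul, eval_C]
    refine mul_ne_zero hqInt fun h => ?_
    simpa [hn.pos.ne'] using congrArg (eval 0) h
  refine .mul hcoprime (.mul (isRelPrime_C_one_sub_X_mul_C hqInt _) ?_ ?_) ?_
  · rw [← qInt_C]
    exact ratCongr_truncSquare_cTermParam_qInt hn
  · refine ratCongr_truncSquare_cTermParam_of_aeval_zpow hn (.inr rfl) fun U hU =>
      one_sub_X_mul_C_dvd_of_aeval_eq_zero (K := RatFunc ℚ) (pow_ne_zero n X_ne_zero) ?_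
    rwa [hqn, ← zpow_natCast, ← zpow_neg]
  · refine ratCongr_truncSquare_cTermParam_of_aeval_zpow hn (.inl rfl) fun U hU =>
      X_sub_C_dvd_of_aeval_eq_zero (K := RatFunc ℚ) ?_
    rwa [hqn, ← zpow_natCast]

end Parametric

section OneVariable

lemma ratCongr_truncSquare_cTerm_cyclotomic {n d : ℕ} (hn : Odd n) (hdn : d ∣ n) (hd : 1 < d) :
    RatCongr (cyclotomic d ℚ) (truncSquare (cTerm (RatFunc.X : RatFunc ℚ)) n)
      (RatFunc.X * qInt RatFunc.X n ^ 2) := by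
  obtain ⟨m, rfl⟩ := hdn
  obtain ⟨N, rfl⟩ := (Nat.odd_mul.1 hn).1
  have hζ := Complex.isPrimitiveRoot_exp (2 * N + 1) (by omega)
  set ζ := Complex.exp _
  let φ : ℚ[X] →+* ℂ := (aeval ζ : ℚ[X] →ₐ[ℚ] ℂ)
  have hq : SpecializesTo φ (RatFunc.X : RatFunc ℚ) ζ := by
    simpa [φ] using SpecializesTo.ratFunc_X φ
  have hζm : ζ ^ ((2 * N + 1) * m) = 1 := by rw [pow_mul, hζ.pow_eq_one, one_pow]
  rw [← cTermParam_one]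
  refine SpecializesTo.ratCongr
    (fun U => (cyclotomic_dvd_iff_aeval_eq_zero (by omega) hζ).2)
    ((SpecializesTo.one φ).truncSquare_cTermParam hq hζ (by omega) ?_ one_ne_zero (.inl rfl) m) ?_
  · exact ratFunc_X_pow_ne_one _ (by omega)
  · have hrhs := hq.mul ((hq.qInt ((2 * N + 1) * m)).pow 2)
    rwa [qInt_eq_zero (hζ.ne_one hd) hζm, zero_pow two_ne_zero, mul_zero] at hrhs

lemma exists_den_not_cyclotomic_dvd_eval_one {n : ℕ} (hn : Odd n) (hn1 : 1 < n) :
    ∃ U V : ℚ[X][X], ¬ cyclotomic n ℚ ∣ evalRingHom 1 V ∧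
      (truncSquare (cTermParam (RatFunc.X : RatFunc ℚ[X]) (RatFunc.C X)) n -
          RatFunc.C X ^ (1 - (n : ℤ)) * qInt (RatFunc.C X) n ^ 2) *
        algebraMap ℚ[X][X] (RatFunc ℚ[X]) V = algebraMap ℚ[X][X] (RatFunc ℚ[X]) U := by
  have hζ := Complex.isPrimitiveRoot_exp n (by omega)
  set ζ := Complex.exp _
  have hζ0 : ζ ≠ 0 := hζ.ne_zero (by omega)
  let φ : ℚ[X][X] →+* ℂ := (aeval ζ : ℚ[X] →ₐ[ℚ] ℂ).toRingHom.comp (evalRingHom 1)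
  have ha : SpecializesTo φ (RatFunc.X : RatFunc ℚ[X]) 1 := by
    simpa [φ] using SpecializesTo.ratFunc_X φ
  have hq : SpecializesTo φ (RatFunc.C (X : ℚ[X])) ζ := by
    simpa [φ] using SpecializesTo.ratFunc_C φ (X : ℚ[X])
  have hsq : IsPrimitiveRoot (ζ ^ 2) n := hζ.pow_of_coprime 2 hn.coprime_two_left
  obtain ⟨U, V, hV, hUV, -⟩ := (ha.truncSquare_cTermParam_of_ne (n := n) hq one_ne_zero hζ0
    (fun i hi hin => by rw [one_mul]; exact hζ.pow_ne_one_of_pos_of_lt hi.ne' hin)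
    (fun i hi hin => hζ.pow_ne_one_of_pos_of_lt hi.ne' hin)
    (fun i hi hin => hsq.pow_ne_one_of_pos_of_lt hi.ne' hin)).sub
      ((hq.zpow hζ0 (1 - (n : ℤ))).mul ((hq.qInt n).pow 2))
  exact ⟨U, V, (cyclotomic_dvd_iff_aeval_eq_zero (by omega) hζ).not.2 hV, hUV⟩

lemma ratCongr_truncSquare_cTerm_zpow {n : ℕ} (hn : Odd n) (hn1 : 1 < n) :
    RatCongr (cyclotomic n ℚ ^ 3) (truncSquare (cTerm (RatFunc.X : RatFunc ℚ)) n)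
      (RatFunc.X ^ (1 - (n : ℤ)) * qInt RatFunc.X n ^ 2) := by
  obtain ⟨U, V, hV, hUV⟩ := exists_den_not_cyclotomic_dvd_eval_one hn hn1
  let ψ : ℚ[X][X] →+* ℚ[X] := evalRingHom 1
  let φ : ℚ[X][X] →+* RatFunc ℚ := (algebraMap ℚ[X] (RatFunc ℚ)).comp ψ
  have ha : SpecializesTo φ (RatFunc.X : RatFunc ℚ[X]) (RatFunc.X ^ (0 : ℤ)) := by
    simpa [φ, ψ] using SpecializesTo.ratFunc_X φ
  have hq : SpecializesTo φ (RatFunc.C (X : ℚ[X])) RatFunc.X := by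
    simpa [φ, ψ] using SpecializesTo.ratFunc_C φ (X : ℚ[X])
  have htrunc := ha.truncSquare_cTermParam_zpow (n := n) hq RatFunc.X_ne_zero
    ratFunc_X_pow_ne_one (.inl rfl)
  rw [zpow_zero, cTermParam_one] at htrunc
  refine (ratCongr_truncSquare_cTermParam hn).map htrunc
    ((hq.zpow RatFunc.X_ne_zero _).mul ((hq.qInt n).pow 2)) ?_ hUV ?_ ?_
  · have hψ : ψ (qInt (C X : ℚ[X][X]) n * (1 - X * C X ^ n) * (X - C X ^ n)) =
        (1 - X ^ n) * qInt (X : ℚ[X]) n ^ 2 * (1 - X) := by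
      simp only [ψ, coe_evalRingHom, qInt_C, eval_mul, eval_sub, eval_one, eval_X, eval_pow,
        eval_C, one_mul, ← one_sub_mul_qInt]
      ring
    rw [hψ]
    exact (cyclotomic_cube_dvd hn1).mul_right _
  · exact fun h => hV (h ▸ dvd_zero _)
  · exact (((cyclotomic.irreducible_rat (by omega)).isRelPrime_iff_not_dvd.2 hV).symm.pow_right)

lemma isRelPrime_X_cyclotomic {n : ℕ} (hn1 : 1 < n) :
    IsRelPrime (X : ℚ[X]) (cyclotomic n ℚ) := by
  rw [irreducible_X.isRelPrime_iff_not_dvd, X_dvd_iff, cyclotomic_coeff_zero ℚ hn1]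
  exact one_ne_zero

lemma ratCongr_zpow_mul_qInt_sq {n : ℕ} (hn1 : 1 < n) :
    RatCongr (cyclotomic n ℚ ^ 3)
      (RatFunc.X ^ (1 - (n : ℤ)) * qInt (RatFunc.X : RatFunc ℚ) n ^ 2)
      (RatFunc.X * qInt RatFunc.X n ^ 2) := by
  obtain ⟨N, hN⟩ := cyclotomic_cube_dvd hn1
  refine ⟨N, X ^ (n - 1), pow_ne_zero _ X_ne_zero,
    (isRelPrime_X_cyclotomic hn1).pow_left.pow_right, ?_⟩
  have hqInt : algebraMap ℚ[X] (RatFunc ℚ) (qInt X n) = qInt RatFunc.X n := by simp [qInt]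
  have hexp : 1 - (n : ℤ) = -((n - 1 : ℕ) : ℤ) := by omega
  have hpow : (RatFunc.X : RatFunc ℚ) ^ n = RatFunc.X ^ (n - 1) * RatFunc.X := by
    rw [← pow_succ, Nat.sub_add_cancel hn1.le]
  have hX : (RatFunc.X : RatFunc ℚ) ≠ 0 := RatFunc.X_ne_zero
  rw [← hN, hexp, zpow_neg, zpow_natCast]
  simp only [map_mul, map_sub, map_one, map_pow, RatFunc.algebraMap_X, hqInt, hpow]
  field_simp

theorem ratCongr_truncSquare_cTerm {n : ℕ} (hn : Odd n) (hn1 : 1 < n) :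
    RatCongr (qInt (X : ℚ[X]) n * cyclotomic n ℚ ^ 2)
      (truncSquare (cTerm (RatFunc.X : RatFunc ℚ)) n) (RatFunc.X * qInt RatFunc.X n ^ 2) := by
  have hmem : n ∈ n.divisors.erase 1 := by simp; omega
  rw [qInt_X_eq_prod_cyclotomic (by omega), ← Finset.prod_erase_mul _ _ hmem, mul_assoc,
    ← pow_succ']
  refine .mul (.pow_right (.prod_left fun d hd => ?_)) (.prod (fun d _ e _ hde => ?_)
    fun d hd => ?_) ((ratCongr_truncSquare_cTerm_zpow hn hn1).trans (ratCongr_zpow_mul_qInt_sq hn1))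
  · exact (cyclotomic.isCoprime_rat (Finset.ne_of_mem_erase hd)).isRelPrime
  · exact (cyclotomic.isCoprime_rat hde).isRelPrime
  · rw [Finset.mem_erase, Finset.mem_erase, Nat.mem_divisors] at hd
    have hd0 := Nat.pos_of_dvd_of_pos hd.2.2.1 (by omega : 0 < n)
    exact ratCongr_truncSquare_cTerm_cyclotomic hn hd.2.2.1 (by omega)

end OneVariable

/-- In the first part `q` is the variable of `ℚ(q)`. In the second part the polynomial ring is
`ℚ[q][a]`: `a` is the outer variable `X` and `q` is the constant `C X`. -/
theorem theorem1 (n : ℕ) (hn : Odd n) :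
    (1 < n →
      RatCongr (qInt (X : ℚ[X]) n * cyclotomic n ℚ ^ 2)
        (truncSquare (cTerm (RatFunc.X : RatFunc ℚ)) n)
        (RatFunc.X * qInt (RatFunc.X : RatFunc ℚ) n ^ 2)) ∧
      RatCongr
        (qInt (C X : ℚ[X][X]) n * (1 - X * (C X) ^ n) * (X - (C X) ^ n))
        (truncSquare (cTermParam (RatFunc.X : RatFunc ℚ[X]) (RatFunc.C (X : ℚ[X]))) n)
        (RatFunc.C (X : ℚ[X]) ^ (1 - (n : ℤ)) * qInt (RatFunc.C (X : ℚ[X])) n ^ 2) :=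
  ⟨fun hn1 => ratCongr_truncSquare_cTerm hn hn1, ratCongr_truncSquare_cTermParam hn⟩
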